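/- Let $n\ge 4$. In the symmetric group $S_n$ (one-line notation in square brackets; the product is composition, $(\pi g)(k)=\pi(g(k))$), let $s=[n\ \,n-1\ \dots\ 1]$ be the full reversal, $r=[2\ 3\ \dots\ n\ 1]$ the left shift, and $\delta=(1\,2)$. Let $\Gamma$ be the Cayley graph of $S_n$ with generators $\delta, r, r^{-1}$ (each $\pi\in S_n$ is adjacent to $\pi\delta$, $\pi r$ and $\pi r^{-1}$, every edge having length $1$), and let $\mathrm{dist}$ be the graph distance in $\Gamma$; thus $\mathrm{dist}(\pi,())$ is the length of a shortest word in $\delta, r, r^{-1}$ representing $\pi$. Then for every $i\in\{1,\dots,n\}$ $$ \mathrm{dist}(sr^{n-i},()) = \left\lceil\tfrac n2\right\rceil\left(\left\lceil\tfrac n2\right\rceil-1\right)-1+\left\lfloor\tfrac n2\right\rfloor\left(\left\lfloor\tfrac n2\right\rfloor-1\right)-1+ \begin{cases} \left\lfloor\frac n2\right\rfloor+1, & i=1,\\ \left\lfloor\frac n2\right\rfloor-i+4, & 2\le i\le\left\lfloor\frac n2\right\rfloor+2,\\ i-\left\lceil\frac n2\right\rceil, & \left\lceil\frac n2\right\rceil+2\le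 i\le n. \end{cases} $$ (The three cases cover all $i\in\{1,\dots,n\}$; the last two overlap only for even $n$ at $i=\frac n2+2$, where they agree.) -/

import Mathlib

/-- The left shift `r = [2 3 … n 1]` in `S_n`, acting on the positions `0, …, n - 1`. -/
def leftShift (n : ℕ) : Equiv.Perm (Fin n) := finRotate n

/-- The full reversal `s = [n n-1 … 1]` in `S_n`. -/
def fullReversal (n : ℕ) : Equiv.Perm (Fin n) := Fin.revPerm

/-- The transposition `δ = (1 2)` in `S_n` for `n ≥ 2`; it swaps the first two positions,
which carry the numbers `0` and `1` here. -/
def firstSwap (n : ℕ) (hn : 2 ≤ n) : Equiv.Perm (Fin n) :=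
  Equiv.swap ⟨0, by omega⟩ ⟨1, by omega⟩

/-- The Cayley graph `Γ` of `S_n` with generators `δ, r, r⁻¹`: the neighbours of `π` are
`π * δ`, `π * r` and `π * r⁻¹`, where `(π * g) k = π (g k)`. -/
def shiftSwapGraph (n : ℕ) (hn : 2 ≤ n) : SimpleGraph (Equiv.Perm (Fin n)) :=
  SimpleGraph.mulCayley {firstSwap n hn, leftShift n, (leftShift n)⁻¹}

open Equiv SimpleGraph

/-! ### The generators acting on positions -/

/-! Read a word as labels on a circle of `n` places with a moving head: `r` and `r⁻¹` move the head,
`δ` swaps the two labels at it. The permutations `s r ^ (n - i)` are reflections of the circle that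
differ in where the head stops. Put a = ⌊n/2⌋, b = ⌈n/2⌉, B = b(b-1) + a(a-1).

Upper bound. Cut the circle into arcs of a and b places and reverse each one. Nested transpositions
reverse an arc of m places with m(m-1) - 1 letters, going from its edge to its middle
(`block_reversal`). Running one such word backwards and mirroring the other gives a route from
middle to middle with two moves in between, B letters in all (`two_blocks`). This reaches i = a+2
and i = b+2. The other i follow by further shifts, with i = 1 treated as i = n+1.

Lower bound. Swaps and head moves are bounded separately. With the two places at the head contracted
to one, a move changes one token by one and a swap changes none. A reflection forces final token +
initial token = c + defect + (n-1)z for each label. Two labels whose z have equal parity must change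
their order, which needs a swap of that pair; balanced parity classes are the cheapest. For the
moves, the triangle inequality through the tokens at any chosen time bounds the sum of the distances
from 2·token - c to the multiples of n-1 by the number of moves plus the number of labels with
nonzero defect. Modulo n-1 the tokens fill every residue once and the head's residue twice, so the
best time is when the head is about halfway between two reflection centres. Such a time exists,
since otherwise the head would miss a place whose token has to move (`exists_head_dvd`,
`exists_crossing`).

Together the word length plus the number of defective labels is at least B + a (`length_lower`).
Shifting c by one trades defective labels for the others: i-2 or n-i+2 of them when i ≥ 2, one when
i = 1. These match the upper bounds. -/

lemma leftShift_val {n : ℕ} (x : Fin n) :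
    ((leftShift n x : Fin n) : ℕ) = if (x : ℕ) + 1 = n then 0 else (x : ℕ) + 1 := by
  obtain _ | n := n
  · exact x.elim0
  · rw [leftShift, coe_finRotate]
    simp [Fin.ext_iff]

lemma fullReversal_val {n : ℕ} (x : Fin n) :
    ((fullReversal n x : Fin n) : ℕ) = n - (x + 1) := by
  simp [fullReversal, Fin.val_rev]

lemma firstSwap_val {n : ℕ} (hn : 2 ≤ n) (x : Fin n) :
    ((firstSwap n hn x : Fin n) : ℕ) =
      if (x : ℕ) = 0 then 1 else if (x : ℕ) = 1 then 0 else (x : ℕ) := by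
  unfold firstSwap
  rw [swap_apply_def]
  simp only [Fin.ext_iff]
  split_ifs <;> rfl

lemma firstSwap_inv {n : ℕ} (hn : 2 ≤ n) : (firstSwap n hn)⁻¹ = firstSwap n hn :=
  swap_inv _ _

/-- Two elements of `Fin n` agree when their values are congruent modulo `n`. -/
lemma Fin.eq_of_val_modEq {n : ℕ} {x y : Fin n} (h : (x : ℤ) ≡ (y : ℤ) [ZMOD n]) : x = y := by
  have hx := x.2
  have hy := y.2
  rw [Int.ModEq, Int.emod_eq_of_lt (by omega) (by omega), Int.emod_eq_of_lt (by omega) (by omega)]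
    at h
  exact Fin.ext (by exact_mod_cast h)

lemma leftShift_modEq {n : ℕ} (x : Fin n) : ((leftShift n x : Fin n) : ℤ) ≡ x + 1 [ZMOD n] := by
  have := leftShift_val x
  split_ifs at this with h
  · rw [this, show ((x : ℕ) : ℤ) + 1 = n by exact_mod_cast h]
    simp [Int.ModEq]
  · rw [this]; push_cast; rfl

lemma leftShift_zpow_modEq {n : ℕ} (k : ℤ) (x : Fin n) :
    (((leftShift n ^ k) x : Fin n) : ℤ) ≡ x + k [ZMOD n] := by
  induction k using Int.induction_on with
  | zero => simp [Int.ModEq]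
  | succ k ih =>
    rw [add_comm, zpow_add, zpow_one, Perm.mul_apply]
    refine (leftShift_modEq _).trans ?_
    rw [show (x : ℤ) + (1 + k) = x + k + 1 by ring]
    exact ih.add_right 1
  | pred k ih =>
    have h := leftShift_modEq ((leftShift n ^ (-(k : ℤ) - 1)) x)
    rw [← Perm.mul_apply, ← zpow_one_add, show 1 + (-(k : ℤ) - 1) = -k by ring] at h
    have h2 := (h.symm.trans ih).sub_right 1
    rw [add_sub_cancel_right] at h2
    rw [show (x : ℤ) + (-k - 1) = x + -k - 1 by ring]
    exact h2

lemma fullReversal_modEq {n : ℕ} (x : Fin n) :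
    ((fullReversal n x : Fin n) : ℤ) ≡ -1 - x [ZMOD n] := by
  have := x.2
  rw [fullReversal_val, Nat.cast_sub (by omega)]
  refine (Int.modEq_iff_dvd).2 ⟨-1, ?_⟩
  push_cast; ring

/-- The one-line notation of `s r ^ k` modulo `n`. -/
lemma fullReversal_mul_leftShift_zpow_modEq {n : ℕ} (k : ℤ) (x : Fin n) :
    (((fullReversal n * leftShift n ^ k) x : Fin n) : ℤ) ≡ -1 - k - x [ZMOD n] := by
  rw [Perm.mul_apply]
  refine (fullReversal_modEq _).trans ?_
  rw [show -1 - k - (x : ℤ) = -1 - (x + k) by ring]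
  exact (leftShift_zpow_modEq k x).sub_left _

/-! ### Words in the generators -/

/-- `HasWord n hn k π` says that `π` is a product of `k` letters from `δ, r, r⁻¹`. -/
inductive HasWord (n : ℕ) (hn : 2 ≤ n) : ℕ → Perm (Fin n) → Prop
  | one : HasWord n hn 0 1
  | swap {k π} : HasWord n hn k π → HasWord n hn (k + 1) (π * firstSwap n hn)
  | fwd {k π} : HasWord n hn k π → HasWord n hn (k + 1) (π * leftShift n)
  | bwd {k π} : HasWord n hn k π → HasWord n hn (k + 1) (π * (leftShift n)⁻¹)

namespace HasWord
variable {n : ℕ} {hn : 2 ≤ n} {k l : ℕ} {π ρ : Perm (Fin n)}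

lemma mul (h : HasWord n hn k π) (h' : HasWord n hn l ρ) : HasWord n hn (k + l) (π * ρ) := by
  induction h' with
  | one => simpa using h
  | swap _ ih => rw [← mul_assoc]; exact ih.swap
  | fwd _ ih => rw [← mul_assoc]; exact ih.fwd
  | bwd _ ih => rw [← mul_assoc]; exact ih.bwd

lemma firstSwap : HasWord n hn 1 (firstSwap n hn) := by
  simpa using (one (hn := hn)).swap

lemma leftShift : HasWord n hn 1 (leftShift n) := by
  simpa using (one (hn := hn)).fwd

lemma leftShift_inv : HasWord n hn 1 (_root_.leftShift n)⁻¹ := by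
  simpa using (one (hn := hn)).bwd

lemma inv (h : HasWord n hn k π) : HasWord n hn k π⁻¹ := by
  induction h with
  | one => simpa using one
  | swap _ ih => rw [mul_inv_rev, firstSwap_inv, add_comm]; exact firstSwap.mul ih
  | fwd _ ih => rw [mul_inv_rev, add_comm]; exact leftShift_inv.mul ih
  | bwd _ ih => rw [mul_inv_rev, inv_inv, add_comm]; exact leftShift.mul ih

lemma leftShift_pow (k : ℕ) : HasWord n hn k (_root_.leftShift n ^ k) := by
  induction k with
  | zero => simpa using one
  | succ k ih => rw [pow_succ]; exact ih.fwd

/-- Conjugation by the reflection exchanging the first two positions inverts the shift and fixes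
the swap, so it preserves word lengths. -/
lemma mirror {τ : Perm (Fin n)} (hτ : ∀ x, ((τ x : Fin n) : ℤ) ≡ 1 - x [ZMOD n])
    (h : HasWord n hn k π) : HasWord n hn k (τ * π * τ⁻¹) := by
  have hr : τ * _root_.leftShift n * τ⁻¹ = (_root_.leftShift n)⁻¹ := by
    rw [mul_inv_eq_iff_eq_mul, eq_inv_mul_iff_mul_eq]
    ext1 x
    refine Fin.eq_of_val_modEq ((leftShift_modEq _).trans ?_)
    refine (((hτ _).add_right 1).trans ?_).trans (hτ x).symm
    have := ((leftShift_modEq x).sub_left 1).add_right 1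
    rw [show 1 - ((x : ℤ) + 1) + 1 = 1 - x by ring] at this
    exact this
  have hs : τ * _root_.firstSwap n hn * τ⁻¹ = _root_.firstSwap n hn := by
    have h0 : τ ⟨0, by omega⟩ = ⟨1, by omega⟩ :=
      Fin.eq_of_val_modEq (by simpa using hτ ⟨0, by omega⟩)
    have h1 : τ ⟨1, by omega⟩ = ⟨0, by omega⟩ :=
      Fin.eq_of_val_modEq (by simpa using hτ ⟨1, by omega⟩)
    unfold _root_.firstSwap
    rw [← swap_apply_apply, h0, h1, swap_comm]
  have key : ∀ a b : Perm (Fin n), τ * (a * b) * τ⁻¹ = (τ * a * τ⁻¹) * (τ * b * τ⁻¹) := by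
    intro a b; group
  induction h with
  | one => simpa using one
  | swap _ ih => rw [key, hs]; exact ih.swap
  | fwd _ ih => rw [key, hr]; exact ih.bwd
  | bwd _ ih =>
    rw [key, show τ * (_root_.leftShift n)⁻¹ * τ⁻¹ = _root_.leftShift n by
      rw [← conj_inv, hr, inv_inv]]
    exact ih.fwd

lemma exists_walk (h : HasWord n hn k π) :
    ∃ p : (shiftSwapGraph n hn).Walk π 1, p.length ≤ k := by
  have step : ∀ {k : ℕ} {π g : Perm (Fin n)},
      g ∈ ({_root_.firstSwap n hn, _root_.leftShift n, (_root_.leftShift n)⁻¹} :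
        Set (Perm (Fin n))) →
      (∃ p : (shiftSwapGraph n hn).Walk π 1, p.length ≤ k) →
      ∃ p : (shiftSwapGraph n hn).Walk (π * g) 1, p.length ≤ k + 1 := by
    rintro k π g hg ⟨p, hp⟩
    by_cases hne : π * g = π
    · rw [hne]; exact ⟨p, by omega⟩
    · have hadj : (shiftSwapGraph n hn).Adj (π * g) π :=
        (mulCayley_adj' _ _ _).2 ⟨hne, g, hg, Or.inr rfl⟩
      exact ⟨p.cons hadj, by simpa using hp⟩
  induction h with
  | one => exact ⟨Walk.nil, le_rfl⟩
  | swap _ ih => exact step (by simp) ih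
  | fwd _ ih => exact step (by simp) ih
  | bwd _ ih => exact step (by simp) ih

lemma dist_le (h : HasWord n hn k π) : (shiftSwapGraph n hn).dist π 1 ≤ k := by
  obtain ⟨p, hp⟩ := h.exists_walk
  exact (SimpleGraph.dist_le p).trans hp

lemma of_walk (p : (shiftSwapGraph n hn).Walk π ρ) (hρ : ρ = 1) : HasWord n hn p.length π := by
  induction p with
  | nil => subst hρ; exact one
  | @cons u v w hadj p ih =>
    obtain ⟨-, g, hg, h⟩ := (mulCayley_adj' _ _ _).1 hadj
    have hu : u = v * g⁻¹ ∨ u = v * g := by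
      rcases h with h | h
      · left; rw [← h, mul_inv_cancel_right]
      · exact Or.inr h
    have ih := ih hρ
    rw [Walk.length_cons]
    simp only [Set.mem_insert_iff, Set.mem_singleton_iff] at hg
    rcases hg with rfl | rfl | rfl <;> rcases hu with rfl | rfl
    · rw [firstSwap_inv]; exact ih.swap
    · exact ih.swap
    · exact ih.bwd
    · exact ih.fwd
    · rw [inv_inv]; exact ih.fwd
    · exact ih.bwd

/-- Every permutation that has some word has one whose length is its distance to `1`. -/
lemma hasWord_dist (h : HasWord n hn k π) : HasWord n hn ((shiftSwapGraph n hn).dist π 1) π := by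
  obtain ⟨p, -⟩ := h.exists_walk
  obtain ⟨q, hq⟩ := p.reachable.exists_walk_length_eq_dist
  rw [← hq]
  exact of_walk q rfl

/-! ### Short words for reversals (upper bound) -/

/-- Carrying the first label `d` places to the right and its partner back to the left. -/
lemma swap_zero (d : ℕ) (hd : d + 1 < n) :
    HasWord n hn (4 * d + 1) (Equiv.swap ⟨0, by omega⟩ ⟨d + 1, hd⟩) := by
  induction d with
  | zero => exact firstSwap
  | succ d ih =>
    have h := (((firstSwap (hn := hn)).mul leftShift).mul (ih (by omega))).bwd.swap
    rw [show 1 + 1 + (4 * d + 1) + 1 + 1 = 4 * (d + 1) + 1 by ring] at h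
    convert h using 1
    have e0 : _root_.leftShift n ⟨0, by omega⟩ = ⟨1, by omega⟩ :=
      Fin.ext (by rw [leftShift_val]; simp; omega)
    have e1 : _root_.leftShift n ⟨d + 1, by omega⟩ = ⟨d + 1 + 1, hd⟩ :=
      Fin.ext (by rw [leftShift_val]; simp; omega)
    have f1 : _root_.firstSwap n hn ⟨1, by omega⟩ = ⟨0, by omega⟩ :=
      Fin.ext (by rw [firstSwap_val]; simp)
    have f2 : _root_.firstSwap n hn ⟨d + 1 + 1, hd⟩ = ⟨d + 1 + 1, hd⟩ :=
      Fin.ext (by rw [firstSwap_val]; simp)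
    rw [mul_assoc (_root_.firstSwap n hn), mul_assoc (_root_.firstSwap n hn), ← swap_apply_apply,
      e0, e1]
    nth_rw 2 [← firstSwap_inv hn]
    rw [← swap_apply_apply, f1, f2]

/-- Reversal of the block of positions `0, …, d`, ending near the middle of the block. -/
lemma block_reversal (d : ℕ) (hd1 : 1 ≤ d) (hd : d + 1 < n) :
    ∃ ρ : Perm (Fin n), (∀ x, ((ρ x : Fin n) : ℕ) = if (x : ℕ) ≤ d then d - x else x) ∧
      HasWord n hn (d * (d + 1) - 1) (ρ * _root_.leftShift n ^ ((d - 1) / 2)) := by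
  induction d using Nat.strong_induction_on with
  | _ d ih =>
    have hsw : ∀ x : Fin n, ((Equiv.swap (⟨0, by omega⟩ : Fin n) ⟨d, by omega⟩ x : Fin n) : ℕ) =
        if (x : ℕ) = 0 then d else if (x : ℕ) = d then 0 else (x : ℕ) := by
      intro x
      rw [swap_apply_def]
      simp only [Fin.ext_iff]
      split_ifs <;> rfl
    obtain ⟨e, rfl⟩ : ∃ e, d = e + 1 := ⟨d - 1, by omega⟩
    have hT := swap_zero (hn := hn) e (by omega)
    by_cases he : e ≤ 1
    · refine ⟨Equiv.swap ⟨0, by omega⟩ ⟨e + 1, by omega⟩, fun x => ?_, ?_⟩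
      · rw [hsw]
        split_ifs <;> omega
      · convert hT using 1
        · interval_cases e <;> rfl
        · rw [show (e + 1 - 1) / 2 = 0 by omega, pow_zero, mul_one]
    · obtain ⟨ρ, hρ, hw⟩ := ih (e - 1) (by omega) (by omega) (by omega)
      -- The outer transposition is followed by the reversal of the inner block, shifted by one. The
      -- shift back is never carried out; these omitted letters make up the exponent `(d - 1) / 2`.
      have hw' := (hT.mul leftShift).mul hw
      refine ⟨Equiv.swap ⟨0, by omega⟩ ⟨e + 1, by omega⟩ *
        (_root_.leftShift n * ρ * (_root_.leftShift n)⁻¹), fun x => ?_, ?_⟩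
      · have hx := x.2
        set y := (_root_.leftShift n)⁻¹ x with hy
        have hxy : x = _root_.leftShift n y := by simp [hy]
        have h1 := leftShift_val y
        have hy2 := y.2
        rw [← hxy] at h1
        rw [Perm.mul_apply, hsw, Perm.mul_apply, Perm.mul_apply, ← hy, leftShift_val, hρ]
        split_ifs at h1 ⊢ <;> first | contradiction | omega
      · convert hw' using 1
        · obtain ⟨f, rfl⟩ : ∃ f, e = f + 2 := ⟨e - 2, by omega⟩
          have : (f + 2 - 1) * (f + 2 - 1 + 1) = f * f + 3 * f + 2 := by
            rw [show f + 2 - 1 = f + 1 by omega]; ring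
          rw [this]
          have : (f + 2 + 1) * (f + 2 + 1 + 1) = f * f + 7 * f + 12 := by ring
          rw [this]; omega
        · rw [show (e + 1 - 1) / 2 = (e - 1 - 1) / 2 + 1 by omega, pow_succ']
          group

/-- The reflections reached by reversing two complementary blocks, from the middle of the first
to the middle of the second. -/
lemma two_blocks (d₁ d₂ : ℕ) (h₁ : 1 ≤ d₁) (h₂ : 1 ≤ d₂) (hd : d₁ + d₂ + 2 = n) :
    HasWord n hn (d₁ * (d₁ + 1) + d₂ * (d₂ + 1))
      (fullReversal n *
        _root_.leftShift n ^ (-(d₁ : ℤ) - 3 - ((d₂ - 1) / 2 : ℕ) + ((d₁ - 1) / 2 : ℕ))) := by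
  obtain ⟨ρ₁, hρ₁, w₁⟩ := block_reversal (hn := hn) d₁ h₁ (by omega)
  obtain ⟨ρ₂, hρ₂, w₂⟩ := block_reversal (hn := hn) d₂ h₂ (by omega)
  set j₁ := (d₁ - 1) / 2
  set j₂ := (d₂ - 1) / 2
  set r := _root_.leftShift n with hr
  obtain ⟨τ, hτ⟩ : ∃ τ : Perm (Fin n), ∀ x, ((τ x : Fin n) : ℤ) ≡ 1 - x [ZMOD n] :=
    ⟨fullReversal n * r ^ (-2 : ℤ), fun x =>
      (fullReversal_mul_leftShift_zpow_modEq (-2) x).trans (by norm_num)⟩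
  -- From the middle of the first block out to its edge, two moves across, then into the second
  -- block, which lies on the other side of the head and so needs the mirrored word. The two moves
  -- use up the two `- 1`s in the block lengths.
  have hw := (w₁.inv.mul (leftShift_pow 2).inv).mul (w₂.mirror hτ)
  have hpos₁ : 1 ≤ d₁ * (d₁ + 1) := Nat.mul_pos h₁ (by omega)
  have hpos₂ : 1 ≤ d₂ * (d₂ + 1) := Nat.mul_pos h₂ (by omega)
  convert hw using 1
  · omega
  ext1 x
  have hn0 : (d₁ : ZMod n) + d₂ + 2 = 0 := by
    have := ZMod.natCast_self n
    rw [← hd] at this ⊢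
    push_cast at this
    exact this
  have cast : ∀ {a b : ℤ}, a ≡ b [ZMOD n] → (a : ZMod n) = b := fun h =>
    (ZMod.intCast_eq_intCast_iff _ _ _).2 h
  have hinv : ∀ x, ρ₁⁻¹ x = ρ₁ x := by
    intro x
    rw [Perm.inv_eq_iff_eq]
    refine Fin.ext ?_
    rw [hρ₁, hρ₁]
    split_ifs <;> omega
  set a₀ := τ⁻¹ x with ha₀
  have hx : x = τ a₀ := by simp [ha₀]
  have e₀ := cast (hτ a₀)
  rw [← hx] at e₀
  set a₁ := (r ^ (j₂ : ℤ)) a₀ with ha₁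
  have e₁ := cast (leftShift_zpow_modEq j₂ a₀)
  set a₃ := τ (ρ₂ a₁) with ha₃
  have e₃ := cast (hτ (ρ₂ a₁))
  set a₄ := (r ^ (-2 : ℤ)) a₃ with ha₄
  have e₄ := cast (leftShift_zpow_modEq (-2) a₃)
  have e₆ := cast (leftShift_zpow_modEq (-j₁) (ρ₁ a₄))
  have et := cast (fullReversal_mul_leftShift_zpow_modEq
    (-(d₁ : ℤ) - 3 - (j₂ : ℕ) + (j₁ : ℕ)) x)
  have hrhs : ((ρ₁ * r ^ j₁)⁻¹ * (r ^ 2)⁻¹ * (τ * (ρ₂ * r ^ j₂) * τ⁻¹)) x =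
      (r ^ (-j₁ : ℤ)) (ρ₁ a₄) := by
    rw [← hinv, ha₄, ha₃, ha₁, ha₀]
    simp only [← Perm.mul_apply]
    congr 1
    group
  rw [hrhs]
  refine Fin.eq_of_val_modEq ((ZMod.intCast_eq_intCast_iff _ _ _).1 ?_)
  rw [← hr] at et e₁ e₄ e₆
  rw [← ha₁] at e₁
  rw [← ha₃] at e₃
  rw [← ha₄] at e₄
  rw [et, e₆]
  have h2 := hρ₂ a₁
  have h1 := hρ₁ a₄
  have ha₁n := a₁.2
  push_cast at e₀ e₁ e₃ e₄ ⊢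
  split_ifs at h2 with hc
  · have h4 : (a₄ : ℕ) = a₁ + d₁ + 1 := by
      have : a₄ = ⟨a₁ + d₁ + 1, by omega⟩ := by
        refine Fin.eq_of_val_modEq ((ZMod.intCast_eq_intCast_iff _ _ _).1 ?_)
        rw [h2] at e₃
        push_cast [hc] at e₃ ⊢
        linear_combination e₄ + e₃ - hn0
      rw [this]
    rw [if_neg (by omega)] at h1
    rw [h1, h4]
    push_cast
    linear_combination -e₀ - e₁
  · have h4 : (a₄ : ℕ) = d₁ + d₂ + 1 - a₁ := by
      have : a₄ = ⟨d₁ + d₂ + 1 - a₁, by omega⟩ := by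
        refine Fin.eq_of_val_modEq ((ZMod.intCast_eq_intCast_iff _ _ _).1 ?_)
        rw [h2] at e₃
        push_cast [show (a₁ : ℕ) ≤ d₁ + d₂ + 1 by omega] at e₃ ⊢
        linear_combination e₄ + e₃ - hn0
      rw [this]
    rw [if_pos (by omega)] at h1
    rw [h1, h4, show d₁ - (d₁ + d₂ + 1 - (a₁ : ℕ)) = a₁ - (d₂ + 1) by omega]
    push_cast [show d₂ + 1 ≤ (a₁ : ℕ) by omega]
    linear_combination -e₀ - e₁ + hn0

lemma fullReversal_mul_congr {l : ℤ} {k' : ℤ}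
    (h : HasWord n hn k (fullReversal n * _root_.leftShift n ^ l)) (hl : l ≡ k' [ZMOD n]) :
    HasWord n hn k (fullReversal n * _root_.leftShift n ^ k') := by
  convert h using 1
  ext1 x
  refine Fin.eq_of_val_modEq ((fullReversal_mul_leftShift_zpow_modEq _ x).trans ?_)
  exact ((hl.symm.sub_left _).sub_right _).trans (fullReversal_mul_leftShift_zpow_modEq _ x).symm

/-- The two nearest reversal-type permutations. -/
lemma nearest_reversal (h4 : 4 ≤ n) (i : ℕ) (hi : i = n / 2 + 2 ∨ i = n - n / 2 + 2) :
    HasWord n hn ((n - n / 2) * (n - n / 2 - 1) + n / 2 * (n / 2 - 1))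
      (fullReversal n * _root_.leftShift n ^ ((n : ℤ) - i)) := by
  obtain ⟨a, ha⟩ : ∃ a, n / 2 = a := ⟨_, rfl⟩
  obtain ⟨b, hb⟩ : ∃ b, n - a = b := ⟨_, rfl⟩
  rw [ha] at hi ⊢
  rw [hb] at hi ⊢
  have w₁ := two_blocks (hn := hn) (b - 1) (a - 1) (by omega) (by omega) (by omega)
  have w₂ := two_blocks (hn := hn) (a - 1) (b - 1) (by omega) (by omega) (by omega)
  rw [show a - 1 + 1 = a by omega, show b - 1 + 1 = b by omega] at w₁ w₂
  rw [mul_comm b, mul_comm a]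
  rw [add_comm] at w₂
  have hcong : ∀ {l : ℤ}, l + n = n - i →
      HasWord n hn ((b - 1) * b + (a - 1) * a) (fullReversal n * _root_.leftShift n ^ l) →
      HasWord n hn ((b - 1) * b + (a - 1) * a)
        (fullReversal n * _root_.leftShift n ^ ((n : ℤ) - i)) := by
    intro l hl h
    refine h.fullReversal_mul_congr ?_
    rw [← hl]
    simp [Int.ModEq]
  -- The floors in the two half-block exponents make the parity of `n / 2` decide which block must
  -- come first.
  rcases Nat.even_or_odd a with ⟨c, hc⟩ | ⟨c, hc⟩ <;> rcases hi with hi | hi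
  · exact hcong (by omega) w₂
  · exact hcong (by omega) w₁
  · exact hcong (by omega) w₁
  · exact hcong (by omega) w₂

lemma reversal_of_le (h4 : 4 ≤ n) (i : ℕ) (hi : i ≤ n / 2 + 2) :
    HasWord n hn ((n - n / 2) * (n - n / 2 - 1) + n / 2 * (n / 2 - 1) + (n / 2 + 2 - i))
      (fullReversal n * _root_.leftShift n ^ ((n : ℤ) - i)) := by
  have h := (nearest_reversal (hn := hn) h4 _ (Or.inl rfl)).mul (leftShift_pow (n / 2 + 2 - i))
  convert h using 1
  rw [mul_assoc, ← zpow_natCast, ← zpow_add]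
  congr 2
  omega

lemma reversal_of_ge (h4 : 4 ≤ n) (i : ℕ) (hi : n - n / 2 + 2 ≤ i) :
    HasWord n hn ((n - n / 2) * (n - n / 2 - 1) + n / 2 * (n / 2 - 1) + (i - (n - n / 2 + 2)))
      (fullReversal n * _root_.leftShift n ^ ((n : ℤ) - i)) := by
  have h := (nearest_reversal (hn := hn) h4 _ (Or.inr rfl)).mul
    (leftShift_pow (i - (n - n / 2 + 2))).inv
  convert h using 1
  rw [mul_assoc, ← zpow_natCast, ← zpow_neg, ← zpow_add]
  congr 2
  omega

end HasWord

/-! ### Configurations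

The labels sit on a circle of `n` places and the swap acts at a moving head. A configuration records
the arrangement seen from the head, the position of the head in the universal cover, and the winding
numbers of the labels. Contracting the two places at the head to one gives every label a `token`, an
integer which only changes when the head moves past the label. -/

structure Conf (n : ℕ) where
  perm : Perm (Fin n)
  head : ℤ
  wind : Fin n → ℤ

namespace Conf
variable {n : ℕ}

def start (n : ℕ) : Conf n := ⟨1, 0, fun _ => 0⟩

def pos (s : Conf n) (u : Fin n) : ℤ := ((s.perm⁻¹ u : Fin n) : ℕ)

def token (s : Conf n) (u : Fin n) : ℤ := s.head + max (s.pos u - 1) 0 + ((n : ℤ) - 1) * s.wind u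

/-- How often the lift of `a` has to pass a lift of `b`. -/
def order (s : Conf n) (a b : Fin n) : ℤ :=
  s.wind b - s.wind a - if s.pos b < s.pos a then 1 else 0

lemma pos_nonneg (s : Conf n) (u : Fin n) : 0 ≤ s.pos u := by simp [pos]

lemma pos_lt (s : Conf n) (u : Fin n) : s.pos u < n := by
  simp [pos]

lemma pos_inj (s : Conf n) {u v : Fin n} (h : s.pos u = s.pos v) : u = v := by
  simp only [pos, Nat.cast_inj] at h
  exact s.perm⁻¹.injective (Fin.ext h)

lemma dvd_token_sub_head (s : Conf n) {u : Fin n} (h : s.pos u ≤ 1) :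
    (n : ℤ) - 1 ∣ s.token u - s.head := by
  rw [token, max_eq_right (by omega)]
  exact ⟨s.wind u, by ring⟩

structure IsSwap (hn : 2 ≤ n) (s t : Conf n) : Prop where
  perm : t.perm = s.perm * firstSwap n hn
  head : t.head = s.head
  wind : t.wind = s.wind

structure IsFwd (s t : Conf n) : Prop where
  perm : t.perm = s.perm * leftShift n
  head : t.head = s.head + 1
  wind : ∀ u, t.wind u = if s.pos u = 0 then s.wind u - 1 else s.wind u

def Step (hn : 2 ≤ n) (s t : Conf n) : Prop := IsSwap hn s t ∨ IsFwd s t ∨ IsFwd t s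

variable {hn : 2 ≤ n} {s t : Conf n}

lemma IsFwd.pos (h : IsFwd s t) (u : Fin n) :
    t.pos u = if s.pos u = 0 then (n : ℤ) - 1 else s.pos u - 1 := by
  have h1 : leftShift n (t.perm⁻¹ u) = s.perm⁻¹ u := by
    rw [h.perm, mul_inv_rev, Perm.mul_apply, ← Perm.mul_apply, mul_inv_cancel, Perm.one_apply]
  have h2 := leftShift_val (t.perm⁻¹ u)
  have h3 := (t.perm⁻¹ u).2
  rw [h1] at h2
  simp only [Conf.pos]
  split_ifs at h2 <;> split_ifs <;> omega

lemma IsSwap.pos (h : IsSwap hn s t) (u : Fin n) :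
    t.pos u = if s.pos u = 0 then 1 else if s.pos u = 1 then 0 else s.pos u := by
  have h1 : firstSwap n hn (s.perm⁻¹ u) = t.perm⁻¹ u := by
    rw [h.perm, mul_inv_rev, Perm.mul_apply, firstSwap_inv]
  have h2 := firstSwap_val hn (s.perm⁻¹ u)
  rw [h1] at h2
  simp only [Conf.pos, h2]
  split_ifs <;> omega

/-- Only a label wrapping from the first to the last position changes its place relative to the
others, and its winding number drops by one to compensate. -/
lemma IsFwd.order (h : IsFwd s t) (a b : Fin n) : t.order a b = s.order a b := by
  rcases eq_or_ne a b with rfl | hab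
  · simp [Conf.order]
  have hne : s.pos a ≠ s.pos b := fun h' => hab (s.pos_inj h')
  have := s.pos_nonneg a
  have := s.pos_nonneg b
  have := s.pos_lt a
  have := s.pos_lt b
  simp only [Conf.order, h.pos, h.wind]
  split_ifs <;> omega

/-- The head passes only the label `w` at position 1. For a label wrapping around, the n-1 in the
winding term absorbs the jump. -/
lemma IsFwd.token (hn : 2 ≤ n) (h : IsFwd s t) : ∃ w, s.pos w = 1 ∧ t.pos w = 0 ∧
    t.token = Function.update s.token w (s.token w + 1) := by
  have hw : s.pos (s.perm ⟨1, by omega⟩) = 1 := by simp [Conf.pos]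
  generalize s.perm ⟨1, by omega⟩ = w at hw
  refine ⟨w, hw, by rw [h.pos, hw]; simp, ?_⟩
  funext u
  have h0 := s.pos_nonneg u
  rcases eq_or_ne u w with rfl | hu
  · rw [Function.update_self, Conf.token, Conf.token, h.pos, h.wind, h.head, hw]
    simp; ring
  · have hne : s.pos u ≠ 1 := fun h' => hu (s.pos_inj (h'.trans hw.symm))
    rw [Function.update_of_ne hu, Conf.token, Conf.token, h.pos, h.wind, h.head]
    by_cases hz : s.pos u = 0
    · rw [if_pos hz, if_pos hz, hz, max_eq_left (by omega), max_eq_right (by omega)]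
      ring
    · rw [if_neg hz, if_neg hz, max_eq_left (by omega), max_eq_left (by omega)]
      ring

lemma IsSwap.token (h : IsSwap hn s t) : t.token = s.token := by
  funext u
  rw [Conf.token, Conf.token, h.pos, h.wind, h.head]
  have h0 := s.pos_nonneg u
  congr 2
  split_ifs <;> omega

lemma Step.move (h : Step hn s t) (hst : t.head ≠ s.head) : ∃ w ε, (ε = 1 ∨ ε = -1) ∧
    (n : ℤ) - 1 ∣ s.token w - s.head ∧ t.head = s.head + ε ∧
    t.token = Function.update s.token w (s.token w + ε) ∧
    ∀ a b, t.order a b = s.order a b := by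
  rcases h with h | h | h
  · exact absurd h.head hst
  · obtain ⟨w, hw, -, ht⟩ := h.token hn
    exact ⟨w, 1, Or.inl rfl, s.dvd_token_sub_head hw.le, h.head, ht, h.order⟩
  · obtain ⟨w, -, hw, ht⟩ := h.token hn
    refine ⟨w, -1, Or.inr rfl, s.dvd_token_sub_head (by omega), by rw [h.head]; ring, ?_,
      fun a b => (h.order a b).symm⟩
    rw [ht]
    simp

lemma Step.swap (h : Step hn s t) (hst : t.head = s.head) : t.token = s.token ∧
    ∃ a b, ∀ c d, t.order c d ≠ s.order c d → (c, d) = (a, b) ∨ (c, d) = (b, a) := by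
  rcases h with h | h | h
  · refine ⟨h.token, s.perm ⟨0, by omega⟩, s.perm ⟨1, by omega⟩, fun c d hcd => ?_⟩
    have p0 : s.pos (s.perm ⟨0, by omega⟩) = 0 := by simp [Conf.pos]
    have p1 : s.pos (s.perm ⟨1, by omega⟩) = 1 := by simp [Conf.pos]
    have key : (s.pos c = 0 ∧ s.pos d = 1) ∨ (s.pos c = 1 ∧ s.pos d = 0) := by
      by_contra hne
      refine hcd ?_
      rcases eq_or_ne c d with rfl | hne'
      · simp [Conf.order]
      have := mt (s.pos_inj (u := c) (v := d)) hne'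
      have := s.pos_nonneg c
      have := s.pos_nonneg d
      simp only [Conf.order, h.pos, h.wind]
      split_ifs <;> omega
    rcases key with ⟨hc, hd⟩ | ⟨hc, hd⟩
    · exact Or.inl (Prod.ext (s.pos_inj (hc.trans p0.symm)) (s.pos_inj (hd.trans p1.symm)))
    · exact Or.inr (Prod.ext (s.pos_inj (hc.trans p1.symm)) (s.pos_inj (hd.trans p0.symm)))
  · exact absurd hst (by rw [h.head]; omega)
  · exact absurd hst (by rw [h.head]; omega)

end Conf

open Conf

/-- A word gives a sequence of configurations. -/
lemma exists_path_of_hasWord {n : ℕ} {hn : 2 ≤ n} {k : ℕ} {π : Perm (Fin n)}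
    (h : HasWord n hn k π) : ∃ s : ℕ → Conf n, s 0 = start n ∧ (s k).perm = π ∧
      ∀ j < k, Step hn (s j) (s (j + 1)) := by
  have extend : ∀ {k : ℕ} {π ρ : Perm (Fin n)},
      (∃ s : ℕ → Conf n, s 0 = start n ∧ (s k).perm = π ∧ ∀ j < k, Step hn (s j) (s (j + 1))) →
      (∀ s : Conf n, s.perm = π → ∃ t, t.perm = ρ ∧ Step hn s t) →
      ∃ s : ℕ → Conf n, s 0 = start n ∧ (s (k + 1)).perm = ρ ∧
        ∀ j < k + 1, Step hn (s j) (s (j + 1)) := by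
    rintro k π ρ ⟨s, h0, hk, hs⟩ H
    obtain ⟨t, ht, hst⟩ := H (s k) hk
    refine ⟨Function.update s (k + 1) t, ?_, by simpa using ht, fun j hj => ?_⟩
    · rw [Function.update_of_ne (by omega), h0]
    · rcases Nat.lt_succ_iff_lt_or_eq.1 hj with hj | rfl
      · rw [Function.update_of_ne (by omega), Function.update_of_ne (by omega)]
        exact hs j hj
      · rw [Function.update_of_ne (by omega), Function.update_self]
        exact hst
  induction h with
  | one => exact ⟨fun _ => start n, rfl, rfl, fun j hj => absurd hj (by omega)⟩
  | swap _ ih => exact extend ih fun s hs =>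
      ⟨⟨s.perm * firstSwap n hn, s.head, s.wind⟩, by simp [hs], Or.inl ⟨rfl, rfl, rfl⟩⟩
  | fwd _ ih => exact extend ih fun s hs =>
      ⟨⟨s.perm * leftShift n, s.head + 1, fun u => if s.pos u = 0 then s.wind u - 1 else s.wind u⟩,
        by simp [hs], Or.inr (Or.inl ⟨rfl, rfl, fun _ => rfl⟩)⟩
  | bwd _ ih =>
    refine extend ih fun s hs =>
      ⟨⟨s.perm * (leftShift n)⁻¹, s.head - 1,
        fun u => if s.pos u = (n : ℤ) - 1 then s.wind u + 1 else s.wind u⟩,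
        by simp [hs], Or.inr (Or.inr ⟨by simp, by simp, fun u => ?_⟩)⟩
    have h1 : ((s.perm * (leftShift n)⁻¹)⁻¹ u) = leftShift n (s.perm⁻¹ u) := by
      simp
    have h2 := leftShift_val (s.perm⁻¹ u)
    have h3 := (s.perm⁻¹ u).2
    simp only [Conf.pos, h1, h2]
    split_ifs <;> omega

/-! ### Head moves and swaps along a path -/

section Path
variable {n : ℕ} {hn : 2 ≤ n} {L : ℕ} {s : ℕ → Conf n}

/-- The number of moves of the head between two times. -/
def moveCount (s : ℕ → Conf n) (i j : ℕ) : ℕ :=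
  ((Finset.Ico i j).filter fun t => (s (t + 1)).head ≠ (s t).head).card

def swapCount (s : ℕ → Conf n) (j : ℕ) : ℕ :=
  ((Finset.Ico 0 j).filter fun t => (s (t + 1)).head = (s t).head).card

lemma swapCount_add_moveCount (j : ℕ) : swapCount s j + moveCount s 0 j = j := by
  rw [swapCount, moveCount, Finset.card_filter_add_card_filter_not, Nat.card_Ico, Nat.sub_zero]

lemma moveCount_add {i j k : ℕ} (hij : i ≤ j) (hjk : j ≤ k) :
    moveCount s i j + moveCount s j k = moveCount s i k := by
  simp only [moveCount, Finset.card_filter]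
  exact Finset.sum_Ico_consecutive _ hij hjk

lemma moveCount_succ {i j : ℕ} (hij : i ≤ j) : moveCount s i (j + 1) =
    moveCount s i j + if (s (j + 1)).head ≠ (s j).head then 1 else 0 := by
  simp only [moveCount, Finset.card_filter]
  exact Finset.sum_Ico_succ_top hij _

lemma sum_abs_token_sub_le (hs : ∀ j < L, Step hn (s j) (s (j + 1))) {i j : ℕ} (hij : i ≤ j)
    (hj : j ≤ L) : ∑ u, |(s j).token u - (s i).token u| ≤ moveCount s i j := by
  induction j, hij using Nat.le_induction with
  | base => simp [moveCount]
  | succ j hij ih =>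
    have ih := ih (by omega)
    rw [moveCount_succ hij]
    by_cases h : (s (j + 1)).head = (s j).head
    · rw [((hs j (by omega)).swap h).1]
      simpa [h] using ih
    · obtain ⟨w, ε, hε, -, -, ht, -⟩ := (hs j (by omega)).move h
      have hstep : ∀ u, |(s (j + 1)).token u - (s i).token u| ≤
          |(s j).token u - (s i).token u| + if u = w then 1 else 0 := by
        intro u
        rw [ht]
        rcases eq_or_ne u w with rfl | hu
        · rw [Function.update_self, if_pos rfl]
          rw [add_sub_right_comm]
          refine (abs_add_le _ _).trans ?_
          rcases hε with rfl | rfl <;> simp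
        · rw [Function.update_of_ne hu, if_neg hu, add_zero]
      refine (Finset.sum_le_sum fun u _ => hstep u).trans ?_
      rw [Finset.sum_add_distrib, Finset.sum_ite_eq' Finset.univ w]
      simp only [Finset.mem_univ, if_true, if_pos (show (s (j + 1)).head ≠ (s j).head from h)]
      push_cast
      omega

/-- A swap affects the order of one unordered pair, hence of two ordered pairs; head moves affect
none. -/
lemma card_order_ne_le (hs : ∀ j < L, Step hn (s j) (s (j + 1))) {j : ℕ} (hj : j ≤ L) :
    (Finset.univ.filter fun p : Fin n × Fin n =>
      (s j).order p.1 p.2 ≠ (s 0).order p.1 p.2).card ≤ 2 * swapCount s j := by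
  induction j with
  | zero => simp
  | succ j ih =>
    have ih := ih (by omega)
    have hc : swapCount s (j + 1) =
        swapCount s j + if (s (j + 1)).head = (s j).head then 1 else 0 := by
      simp only [swapCount, Finset.card_filter]
      exact Finset.sum_Ico_succ_top (by omega) _
    rw [hc]
    by_cases h : (s (j + 1)).head = (s j).head
    · obtain ⟨-, a, b, hab⟩ := (hs j (by omega)).swap h
      rw [if_pos h]
      have hsub : (Finset.univ.filter fun p : Fin n × Fin n =>
          (s (j + 1)).order p.1 p.2 ≠ (s 0).order p.1 p.2) ⊆
          (Finset.univ.filter fun p : Fin n × Fin n =>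
            (s j).order p.1 p.2 ≠ (s 0).order p.1 p.2) ∪ {(a, b), (b, a)} := by
        intro p hp
        simp only [Finset.mem_filter, Finset.mem_univ, true_and, Finset.mem_union,
          Finset.mem_insert, Finset.mem_singleton] at hp ⊢
        by_cases hp' : (s (j + 1)).order p.1 p.2 = (s j).order p.1 p.2
        · left; rwa [← hp']
        · right; exact hab _ _ hp'
      have := (Finset.card_le_card hsub).trans (Finset.card_union_le _ _)
      have := Finset.card_le_two (a := (a, b)) (b := (b, a))
      omega
    · obtain ⟨w, ε, -, -, -, -, ho⟩ := (hs j (by omega)).move h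
      simp only [ho]
      omega

end Path

/-! ### Sums of periodic functions -/

lemma Function.Periodic.sum_range_add {M : ℕ} {F : ℤ → ℤ} (hF : Function.Periodic F M) (h : ℤ) :
    ∑ j ∈ Finset.range M, F (h + j) = ∑ j ∈ Finset.range M, F j := by
  have step : ∀ h : ℤ, ∑ j ∈ Finset.range M, F (h + 1 + j) = ∑ j ∈ Finset.range M, F (h + j) := by
    intro h
    have h1 := Finset.sum_range_succ (fun j : ℕ => F (h + j)) M
    have h2 := Finset.sum_range_succ' (fun j : ℕ => F (h + j)) M
    rw [h1] at h2
    simp only [Nat.cast_zero, add_zero, hF h] at h2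
    have h3 := add_right_cancel h2
    rw [h3]
    refine Finset.sum_congr rfl fun j _ => ?_
    push_cast
    ring_nf
  induction h using Int.induction_on with
  | zero => simp
  | succ k ih => rw [step, ih]
  | pred k ih => rw [← step, ← ih]; simp

/-- Doubling permutes the residues modulo an odd number. -/
lemma Function.Periodic.sum_range_two_mul {a : ℕ} {F : ℤ → ℤ}
    (hF : Function.Periodic F ((2 * a + 1 : ℕ) : ℤ)) :
    ∑ j ∈ Finset.range (2 * a + 1), F (2 * j) = ∑ j ∈ Finset.range (2 * a + 1), F j := by
  have split : ∀ M : ℕ, ∑ j ∈ Finset.range (2 * M), F j =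
      ∑ j ∈ Finset.range M, F (2 * j) + ∑ j ∈ Finset.range M, F (2 * j + 1) := by
    intro M
    induction M with
    | zero => simp
    | succ M ih =>
      rw [show 2 * (M + 1) = 2 * M + 1 + 1 by ring, Finset.sum_range_succ, Finset.sum_range_succ, ih,
        Finset.sum_range_succ, Finset.sum_range_succ]
      push_cast
      ring
  have hG : Function.Periodic (fun j : ℤ => F (2 * j)) ((2 * a + 1 : ℕ) : ℤ) := by
    intro x
    change F (2 * (x + _)) = F (2 * x)
    rw [mul_add, two_mul ((2 * a + 1 : ℕ) : ℤ), ← add_assoc, hF, hF]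
  have hodd : ∑ j ∈ Finset.range (2 * a + 1), F (2 * j + 1) =
      ∑ j ∈ Finset.range (2 * a + 1), F (2 * j) := by
    rw [← hG.sum_range_add (a + 1)]
    refine Finset.sum_congr rfl fun j _ => ?_
    rw [← hF]
    congr 1
    push_cast
    ring
  have hsum : ∑ j ∈ Finset.range (2 * (2 * a + 1)), F j =
      2 * ∑ j ∈ Finset.range (2 * a + 1), F j := by
    have hshift : ∀ j ∈ Finset.range (2 * a + 1), F ((2 * a + 1 + j : ℕ) : ℤ) = F j := by
      intro j _
      rw [add_comm (2 * a + 1), Nat.cast_add, hF]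
    rw [two_mul (2 * a + 1), Finset.sum_range_add, Finset.sum_congr rfl hshift]
    ring
  rw [split (2 * a + 1), hodd] at hsum
  omega

/-- Modulo n-1 the tokens run through all residues once, and the head's residue occurs once more
because positions 0 and 1 share it. -/
lemma Conf.sum_token {n : ℕ} (hn : 2 ≤ n) (s : Conf n) {F : ℤ → ℤ}
    (hF : Function.Periodic F ((n - 1 : ℕ) : ℤ)) :
    ∑ u, F (s.token u) = ∑ j ∈ Finset.range (n - 1), F j + F s.head := by
  have h1 : ∀ u, F (s.token u) = F (s.head + max (s.pos u - 1) 0) := by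
    intro u
    rw [token, mul_comm, show (n : ℤ) - 1 = ((n - 1 : ℕ) : ℤ) by omega]
    exact hF.int_mul _ _
  have h2 : ∑ u, F (s.head + max (s.pos u - 1) 0) =
      ∑ x : Fin n, F (s.head + max (((x : ℕ) : ℤ) - 1) 0) :=
    Equiv.sum_comp s.perm⁻¹ fun x : Fin n => F (s.head + max (((x : ℕ) : ℤ) - 1) 0)
  simp only [h1]
  rw [h2, Fin.sum_univ_eq_sum_range (fun x : ℕ => F (s.head + max ((x : ℤ) - 1) 0)) n]
  obtain ⟨m, rfl⟩ : ∃ m, n = m + 1 := ⟨n - 1, by omega⟩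
  rw [Finset.sum_range_succ', ← hF.sum_range_add s.head]
  simp

/-! ### Distance to the multiples of an integer -/

/-- The distance from `y` to the nearest multiple of `N`. -/
def distMul (N y : ℤ) : ℤ := min (y % N) (N - y % N)

lemma distMul_periodic (N : ℤ) : Function.Periodic (distMul N) N := by
  intro y
  simp [distMul]

lemma distMul_of_dvd {N y v : ℤ} (h : N ∣ y - v) (h0 : 0 ≤ v) (hv : v < N) :
    distMul N y = min v (N - v) := by
  have : y % N = v := by
    rw [← Int.emod_eq_of_lt h0 hv]
    exact ((Int.modEq_iff_dvd).2 h).symm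
  rw [distMul, this]

lemma distMul_le_abs {N : ℤ} (hN : 0 < N) (y z : ℤ) : distMul N y ≤ |y - N * z| := by
  have h1 := Int.emod_nonneg y hN.ne'
  have h2 := Int.emod_lt_of_pos y hN
  have h3 := Int.mul_ediv_add_emod y N
  rw [show y - N * z = N * (y / N - z) + y % N by linear_combination -h3]
  rcases le_or_gt 0 (y / N - z) with h | h
  · have : 0 ≤ N * (y / N - z) := mul_nonneg hN.le h
    exact (min_le_left _ _).trans (le_trans (by omega) (le_abs_self _))
  · have : N * (y / N - z) ≤ N * (-1) := mul_le_mul_of_nonneg_left (by omega) hN.le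
    exact (min_le_right _ _).trans (le_trans (by omega) (neg_le_abs _))

lemma sum_distMul_odd (a : ℕ) (c : ℤ) :
    ∑ j ∈ Finset.range (2 * a + 1), distMul (2 * a + 1 : ℕ) (2 * j - c) = a * (a + 1) := by
  have hF : Function.Periodic (fun y => distMul (2 * a + 1 : ℕ) (y - c)) (2 * a + 1 : ℕ) := by
    intro y
    change distMul _ (y + _ - c) = _
    rw [add_sub_right_comm]
    exact distMul_periodic _ _
  rw [hF.sum_range_two_mul]
  have := (distMul_periodic (2 * a + 1 : ℕ)).sum_range_add (-c)
  simp only [neg_add_eq_sub] at this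
  rw [this]
  have h1 : ∀ j ∈ Finset.range (2 * a + 1),
      distMul (2 * a + 1 : ℕ) j = min (j : ℤ) (2 * a + 1 - j) := by
    intro j hj
    rw [Finset.mem_range] at hj
    rw [distMul_of_dvd (v := j) (by simp) (by omega) (by omega)]
    push_cast
    rfl
  rw [Finset.sum_congr rfl h1]
  clear * -
  induction a with
  | zero => simp
  | succ a ih =>
    rw [show 2 * (a + 1) + 1 = 2 * a + 1 + 1 + 1 by ring, Finset.sum_range_succ,
      Finset.sum_range_succ']
    have h2 : ∀ j ∈ Finset.range (2 * a + 1), min (((j + 1 : ℕ) : ℤ))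
        (2 * ((a + 1 : ℕ) : ℤ) + 1 - ((j + 1 : ℕ) : ℤ)) = min (j : ℤ) (2 * a + 1 - j) + 1 := by
      intro j _
      push_cast
      omega
    rw [Finset.sum_congr rfl h2, Finset.sum_add_distrib, ih]
    have h3 : min (((2 * a + 1 + 1 : ℕ) : ℤ))
        (2 * ((a + 1 : ℕ) : ℤ) + 1 - ((2 * a + 1 + 1 : ℕ) : ℤ)) = 1 := by push_cast; omega
    have h4 : min (((0 : ℕ) : ℤ)) (2 * ((a + 1 : ℕ) : ℤ) + 1 - ((0 : ℕ) : ℤ)) = 0 := by omega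
    rw [h3, h4]
    simp
    ring

/-- Passing from a to a+2 adds the end terms ε and 2-ε and raises each of the a inner terms by 2, so
twice the sum grows by 4a+4 = (a+2)² - a². -/
lemma sq_le_two_mul_sum_min (a : ℕ) (ε : ℤ) (h0 : 0 ≤ ε) (h1 : ε ≤ 1) :
    (a : ℤ) ^ 2 - (if ε % 2 = a % 2 then 0 else 1) ≤
      2 * ∑ j ∈ Finset.range a, min (2 * (j : ℤ) + ε) (2 * a - 2 * j - ε) := by
  induction a using Nat.twoStepInduction with
  | zero => simp; split_ifs <;> simp
  | one =>
    obtain rfl | rfl : ε = 0 ∨ ε = 1 := by omega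
    · simp
    · simp
  | more a ih _ =>
    rw [Finset.sum_range_succ, Finset.sum_range_succ']
    have h2 : ∀ j ∈ Finset.range a, min (2 * ((j + 1 : ℕ) : ℤ) + ε)
        (2 * ((a + 2 : ℕ) : ℤ) - 2 * ((j + 1 : ℕ) : ℤ) - ε) =
        min (2 * (j : ℤ) + ε) (2 * a - 2 * j - ε) + 2 := by
      intro j _
      push_cast
      omega
    rw [Finset.sum_congr rfl h2, Finset.sum_add_distrib]
    have h3 : min (2 * ((a + 1 : ℕ) : ℤ) + ε) (2 * ((a + 2 : ℕ) : ℤ) - 2 * ((a + 1 : ℕ) : ℤ) - ε) =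
      2 - ε := by push_cast; omega
    have h4 : min (2 * ((0 : ℕ) : ℤ) + ε) (2 * ((a + 2 : ℕ) : ℤ) - 2 * ((0 : ℕ) : ℤ) - ε) = ε := by
      push_cast; omega
    rw [h3, h4]
    have h5 : ((a + 2 : ℕ) : ℤ) % 2 = (a : ℤ) % 2 := by omega
    rw [h5]
    simp only [Finset.sum_const, Finset.card_range, nsmul_eq_mul]
    push_cast
    have : ((a : ℤ) + 2) ^ 2 = a ^ 2 + 4 * a + 4 := by ring
    rw [this]
    linarith

lemma sq_le_sum_distMul_even (a : ℕ) (c : ℤ) :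
    (a : ℤ) ^ 2 - (if c % 2 = a % 2 then 0 else 1) ≤
      ∑ j ∈ Finset.range (2 * a), distMul (2 * a : ℕ) (2 * j - c) := by
  set ε := c % 2 with hε
  have h0 : 0 ≤ ε := by omega
  have h1 : ε ≤ 1 := by omega
  have hc : c = 2 * (c / 2) + ε := by omega
  have hF : Function.Periodic (fun y : ℤ => distMul (2 * a : ℕ) (2 * y + ε)) (2 * a : ℕ) := by
    intro y
    change distMul _ (2 * (y + _) + ε) = _
    rw [show 2 * (y + ((2 * a : ℕ) : ℤ)) + ε = 2 * y + ε + ((2 * a : ℕ) : ℤ) + ((2 * a : ℕ) : ℤ) by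
      ring, distMul_periodic, distMul_periodic]
  have hs := hF.sum_range_add (-(c / 2) - ε)
  have hs' : ∑ j ∈ Finset.range (2 * a), distMul (2 * a : ℕ) (2 * j - c) =
      ∑ j ∈ Finset.range (2 * a), distMul (2 * a : ℕ) (2 * j + ε) := by
    rw [← hs]
    refine Finset.sum_congr rfl fun j _ => ?_
    congr 1
    omega
  rw [hs', two_mul a, Finset.sum_range_add, ← two_mul a]
  have h2 : ∑ j ∈ Finset.range a, distMul (2 * a : ℕ) (2 * ((a + j : ℕ) : ℤ) + ε) =
      ∑ j ∈ Finset.range a, distMul (2 * a : ℕ) (2 * j + ε) := by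
    refine Finset.sum_congr rfl fun j _ => ?_
    rw [← distMul_periodic _ (2 * (j : ℤ) + ε)]
    congr 1
    push_cast
    ring
  have h3 : ∀ j ∈ Finset.range a, distMul (2 * a : ℕ) (2 * j + ε) =
      min (2 * (j : ℤ) + ε) (2 * a - 2 * j - ε) := by
    intro j hj
    rw [Finset.mem_range] at hj
    rw [distMul_of_dvd (v := 2 * j + ε) (by simp) (by omega) (by omega)]
    push_cast
    rw [sub_sub]
  rw [h2, Finset.sum_congr rfl h3, ← two_mul]
  have := sq_le_two_mul_sum_min a ε h0 h1
  rwa [show ε % 2 = ε by omega] at this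

/-! ### Lower bound for the length of a word -/

/-- Pairs of labels in the same class of a two-colouring. -/
lemma card_same_parity {n : ℕ} (z : Fin n → ℤ) :
    (Finset.univ.filter fun p : Fin n × Fin n => z p.1 % 2 = z p.2 % 2).card =
      (Finset.univ.filter fun u => z u % 2 = 0).card ^ 2 +
        (Finset.univ.filter fun u => z u % 2 = 1).card ^ 2 := by
  have h : (Finset.univ.filter fun p : Fin n × Fin n => z p.1 % 2 = z p.2 % 2) =
      ((Finset.univ.filter fun u => z u % 2 = 0) ×ˢ (Finset.univ.filter fun u => z u % 2 = 0)) ∪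
      ((Finset.univ.filter fun u => z u % 2 = 1) ×ˢ (Finset.univ.filter fun u => z u % 2 = 1)) := by
    ext p
    simp only [Finset.mem_filter, Finset.mem_univ, true_and, Finset.mem_union, Finset.mem_product]
    omega
  rw [h, Finset.card_union_of_disjoint, Finset.card_product, Finset.card_product, sq, sq]
  rw [Finset.disjoint_left]
  intro p hp hp'
  simp only [Finset.mem_filter, Finset.mem_univ, true_and, Finset.mem_product] at hp hp'
  omega

/-- A sequence of configurations from the identity to an arrangement in which the tokens are
reflected up to the defects `δ`, and labels with windings of equal parity have been exchanged. -/
structure ReflectingPath {n : ℕ} (hn : 2 ≤ n) (L : ℕ) (s : ℕ → Conf n) (c E : ℤ)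
    (z δ : Fin n → ℤ) : Prop where
  start : s 0 = Conf.start n
  step : ∀ j < L, Step hn (s j) (s (j + 1))
  token : ∀ u, (s L).token u + (s 0).token u = c + δ u + ((n : ℤ) - 1) * z u
  defect : ∀ u, δ u = E ∨ δ u = E + 1
  side : E = -1 ∨ E = 0
  order : ∀ a b, a ≠ b → z a % 2 = z b % 2 → (s L).order a b ≠ (s 0).order a b

namespace ReflectingPath
variable {n : ℕ} {hn : 2 ≤ n} {L : ℕ} {s : ℕ → Conf n} {c E : ℤ} {z δ : Fin n → ℤ}

lemma sq_add_sq_le (h : ReflectingPath hn L s c E z δ) :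
    (Finset.univ.filter fun u => z u % 2 = 0).card ^ 2 +
        (Finset.univ.filter fun u => z u % 2 = 1).card ^ 2 ≤ 2 * swapCount s L + n := by
  rw [← card_same_parity]
  have hsub : (Finset.univ.filter fun p : Fin n × Fin n => z p.1 % 2 = z p.2 % 2) ⊆
      (Finset.univ.filter fun p : Fin n × Fin n =>
        (s L).order p.1 p.2 ≠ (s 0).order p.1 p.2) ∪ (Finset.univ : Finset (Fin n)).diag := by
    intro p hp
    simp only [Finset.mem_filter, Finset.mem_univ, true_and, Finset.mem_union,
      Finset.mem_diag] at hp ⊢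
    by_cases hp' : p.1 = p.2
    · exact Or.inr hp'
    · exact Or.inl (h.order _ _ hp' hp)
  have h1 := (Finset.card_le_card hsub).trans (Finset.card_union_le _ _)
  have h2 := card_order_ne_le h.step le_rfl
  rw [Finset.diag_card, Finset.card_univ, Fintype.card_fin] at h1
  omega

lemma card_parity_add (z : Fin n → ℤ) :
    (Finset.univ.filter fun u => z u % 2 = 0).card +
      (Finset.univ.filter fun u => z u % 2 = 1).card = n := by
  have h := Finset.card_filter_add_card_filter_not (s := (Finset.univ : Finset (Fin n)))
    (fun u => z u % 2 = 0)
  have h2 : (Finset.univ.filter fun u => ¬ z u % 2 = 0) =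
      (Finset.univ.filter fun u => z u % 2 = 1) := by
    ext u
    simp only [Finset.mem_filter, Finset.mem_univ, true_and]
    omega
  rw [h2, Finset.card_univ, Fintype.card_fin] at h
  exact h

/-- Triangle inequality for each token along the times 0, i, j, L. Replacing the final plus initial
token by its reflected value costs at most one per label with nonzero defect. Taking i = j gives the
bound at a place, j = i+1 the bound at an edge. -/
lemma sum_le_moveCount (h : ReflectingPath hn L s c E z δ) {i j : ℕ} (hij : i ≤ j) (hj : j ≤ L) :
    ∑ u, (|(s i).token u + (s j).token u - c - ((n : ℤ) - 1) * z u| +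
        |(s j).token u - (s i).token u|) ≤
      moveCount s 0 L + (Finset.univ.filter fun u => δ u ≠ 0).card := by
  have h1 := sum_abs_token_sub_le h.step (i := 0) (Nat.zero_le i) (by omega)
  have h2 := sum_abs_token_sub_le h.step hij hj
  have h3 := sum_abs_token_sub_le h.step hj le_rfl
  rw [← moveCount_add (s := s) (Nat.zero_le j) hj, ← moveCount_add (s := s) (Nat.zero_le i) hij]
  push_cast
  refine le_trans ?_ (add_le_add_left (add_le_add (add_le_add h1 h2) h3) _)
  rw [Finset.card_filter]
  push_cast
  rw [← Finset.sum_add_distrib, ← Finset.sum_add_distrib, ← Finset.sum_add_distrib]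
  refine Finset.sum_le_sum fun u _ => ?_
  have ht := h.token u
  have hd := h.defect u
  have hE := h.side
  generalize ((n : ℤ) - 1) * z u = w at *
  split_ifs with h0 <;> grind

lemma sum_site_le (h : ReflectingPath hn L s c E z δ) {j : ℕ} (hj : j ≤ L) :
    ∑ u, |2 * (s j).token u - c - ((n : ℤ) - 1) * z u| ≤
      moveCount s 0 L + (Finset.univ.filter fun u => δ u ≠ 0).card := by
  have := h.sum_le_moveCount le_rfl hj
  simpa [two_mul] using this

/-- The tokens at a time when the head sits at a place. -/
lemma sum_distMul_site_le (hn : 2 ≤ n) (s : Conf n) (c : ℤ) (z : Fin n → ℤ) :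
    ∑ q ∈ Finset.range (n - 1), distMul (n - 1 : ℕ) (2 * q - c) +
        distMul (n - 1 : ℕ) (2 * s.head - c) ≤
      ∑ u, |2 * s.token u - c - ((n : ℤ) - 1) * z u| := by
  have hF : Function.Periodic (fun y => distMul (n - 1 : ℕ) (2 * y - c)) (n - 1 : ℕ) := by
    intro y
    change distMul _ (2 * (y + _) - c) = _
    rw [show 2 * (y + ((n - 1 : ℕ) : ℤ)) - c =
      2 * y - c + ((n - 1 : ℕ) : ℤ) + ((n - 1 : ℕ) : ℤ) by ring, distMul_periodic, distMul_periodic]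
  rw [← s.sum_token hn hF]
  refine Finset.sum_le_sum fun u _ => ?_
  have := distMul_le_abs (N := (n - 1 : ℕ)) (by omega) (2 * s.token u - c) (z u)
  rwa [show ((n - 1 : ℕ) : ℤ) = (n : ℤ) - 1 by omega] at this ⊢

/-- The tokens at a time when the head moves from one place to a neighbouring one. -/
lemma sum_distMul_edge_le (h : ReflectingPath hn L s c E z δ) {j : ℕ} (hj : j < L)
    (hmove : (s (j + 1)).head ≠ (s j).head) :
    ∑ q ∈ Finset.range (n - 1), distMul (n - 1 : ℕ) (2 * q - c) +
        distMul (n - 1 : ℕ) ((s j).head + (s (j + 1)).head - c) + 1 ≤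
      moveCount s 0 L + (Finset.univ.filter fun u => δ u ≠ 0).card := by
  refine le_trans ?_ (h.sum_le_moveCount (Nat.le_succ j) hj)
  obtain ⟨w, ε, hε, hdvd, hhead, htok, -⟩ := (h.step j hj).move hmove
  have hN : ((n - 1 : ℕ) : ℤ) = (n : ℤ) - 1 := by omega
  set F := fun y => distMul (n - 1 : ℕ) (2 * y - c) with hFdef
  have hF : Function.Periodic F (n - 1 : ℕ) := by
    intro y
    change distMul _ (2 * (y + _) - c) = _
    rw [show 2 * (y + ((n - 1 : ℕ) : ℤ)) - c =
      2 * y - c + ((n - 1 : ℕ) : ℤ) + ((n - 1 : ℕ) : ℤ) by ring, distMul_periodic, distMul_periodic]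
  have hsum := (s j).sum_token hn hF
  obtain ⟨t, ht⟩ := hdvd
  have hw : (s j).token w = (s j).head + t * ((n - 1 : ℕ) : ℤ) := by
    rw [hN]; linear_combination ht
  have hFw : F ((s j).token w) = F (s j).head := by
    rw [hw]; exact hF.int_mul t _
  have hmid : distMul (n - 1 : ℕ) ((s j).head + (s (j + 1)).head - c) =
      distMul (n - 1 : ℕ) (2 * (s j).token w + ε - c) := by
    rw [hhead, hw, show 2 * ((s j).head + t * ((n - 1 : ℕ) : ℤ)) + ε - c =
      (s j).head + ((s j).head + ε) - c + (2 * t) * ((n - 1 : ℕ) : ℤ) by ring]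
    exact ((distMul_periodic _).int_mul (2 * t) _).symm
  have hle : ∀ u, F ((s j).token u) +
      (if u = w then distMul (n - 1 : ℕ) (2 * (s j).token w + ε - c) - F ((s j).token w) + 1
        else 0) ≤
      |(s j).token u + (s (j + 1)).token u - c - ((n : ℤ) - 1) * z u| +
        |(s (j + 1)).token u - (s j).token u| := by
    intro u
    rw [htok, ← hN]
    by_cases hu : u = w
    · subst hu
      rw [if_pos rfl, Function.update_self]
      have h1 := distMul_le_abs (N := (n - 1 : ℕ)) (by omega) (2 * (s j).token u + ε - c) (z u)
      have h2 : |(s j).token u + ε - (s j).token u| = 1 := by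
        rw [add_sub_cancel_left]
        rcases hε with rfl | rfl <;> simp
      rw [h2, show (s j).token u + ((s j).token u + ε) = 2 * (s j).token u + ε by ring]
      linarith
    · rw [if_neg hu, Function.update_of_ne hu, ← two_mul, add_zero, sub_self, abs_zero, add_zero]
      exact distMul_le_abs (by omega) _ _
  have hfin := Finset.sum_le_sum fun u (_ : u ∈ Finset.univ) => hle u
  rw [Finset.sum_add_distrib, Finset.sum_ite_eq' Finset.univ w, hsum,
    if_pos (Finset.mem_univ w)] at hfin
  rw [hmid]
  refine le_trans (le_of_eq ?_) hfin
  rw [hFw]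
  ring

/-- The head comes to every place `q` at which no token can stay for the whole time. -/
lemma exists_head_dvd (h : ReflectingPath hn L s c E z δ) (q : ℤ)
    (hq : ¬ ((n : ℤ) - 1 ∣ 2 * q - c - E)) (hq' : ¬ ((n : ℤ) - 1 ∣ 2 * q - c - (E + 1))) :
    ∃ j ≤ L, (n : ℤ) - 1 ∣ (s j).head - q := by
  by_contra! hne
  have hpos : (0 : ℤ) < (n : ℤ) - 1 := by omega
  obtain ⟨u, hu⟩ : ∃ u, (n : ℤ) - 1 ∣ (s 0).token u - q := by
    have h0 := Int.emod_nonneg q hpos.ne'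
    have h1 := Int.emod_lt_of_pos q hpos
    -- At the start the label u ≥ 1 has token u - 1. A token moves only when the head is at its
    -- residue, so this one would stay fixed.
    refine ⟨⟨(q % ((n : ℤ) - 1)).toNat + 1, by omega⟩, ?_⟩
    have : (s 0).token ⟨(q % ((n : ℤ) - 1)).toNat + 1, by omega⟩ = q % ((n : ℤ) - 1) := by
      rw [h.start]
      simp [Conf.token, Conf.pos, Conf.start, h0]
    rw [this]
    exact Int.dvd_emod_sub_self
  have hconst : ∀ j ≤ L, (s j).token u = (s 0).token u := by
    intro j
    induction j with
    | zero => simp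
    | succ j ih =>
      intro hj
      rw [← ih (by omega)]
      by_cases hh : (s (j + 1)).head = (s j).head
      · rw [((h.step j hj).swap hh).1]
      · obtain ⟨w, ε, -, hdvd, -, htok, -⟩ := (h.step j hj).move hh
        rw [htok, Function.update_of_ne]
        rintro rfl
        refine hne j (by omega) ?_
        rw [ih (by omega)] at hdvd
        have := dvd_sub hu hdvd
        rwa [show (s 0).token u - q - ((s 0).token u - (s j).head) = (s j).head - q by ring] at this
  have ht := h.token u
  rw [hconst L le_rfl] at ht
  have key : (n : ℤ) - 1 ∣ 2 * q - c - δ u := by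
    have := dvd_sub (Dvd.intro (z u) rfl : (n : ℤ) - 1 ∣ ((n : ℤ) - 1) * z u)
      (hu.mul_left 2)
    rwa [show ((n : ℤ) - 1) * z u - 2 * ((s 0).token u - q) = 2 * q - c - δ u by
      linarith] at this
  rcases h.defect u with hd | hd <;> rw [hd] at key
  · exact hq key
  · exact hq' key

/-- Some move of the head crosses a point halfway between two neighbouring reflection centres. -/
lemma exists_crossing (h : ReflectingPath hn L s c E z δ) (h5 : 5 ≤ n) :
    ∃ j < L, (2 * (s (j + 1)).head - c + (n / 2 : ℕ)) / ((n : ℤ) - 1) ≠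
      (2 * (s j).head - c + (n / 2 : ℕ)) / ((n : ℤ) - 1) := by
  by_contra! hne
  have hpos : (0 : ℤ) < (n : ℤ) - 1 := by omega
  -- `J x` indexes the reflection centre nearest to x; centres are the points where 2x - c is a
  -- multiple of n-1.
  set J := fun x : ℤ => (2 * x - c + (n / 2 : ℕ)) / ((n : ℤ) - 1) with hJ
  have hconst : ∀ j ≤ L, J (s j).head = J (s 0).head := by
    intro j
    induction j with
    | zero => simp
    | succ j ih => intro hj; rw [← ih (by omega)]; exact hne j (by omega)
  obtain ⟨M, hM⟩ : ∃ M, ((n : ℤ) - 1) * (J (s 0).head + 1) = M := ⟨_, rfl⟩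
  have hE := h.side
  -- The offset y avoids both admissible defects E and E+1, with the parity that makes q an integer
  -- near the next centre. The head must visit q modulo n-1. A full turn changes `J` by 2, so every
  -- such visit has an index of the opposite parity to the initial one.
  obtain ⟨y, hy, hpar⟩ : ∃ y : ℤ, ((E = -1 ∧ (y = -2 ∨ y = 1)) ∨ (E = 0 ∧ (y = -2 ∨ y = -1))) ∧
      (M + c + y) % 2 = 0 := by
    rcases Int.emod_two_eq_zero_or_one (M + c) with h2 | h2
    · exact ⟨-2, by omega, by omega⟩
    · rcases hE with hE | hE
      · exact ⟨1, by omega, by omega⟩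
      · exact ⟨-1, by omega, by omega⟩
  obtain ⟨q, hq⟩ : ∃ q, 2 * q = M + c + y := ⟨(M + c + y) / 2, by omega⟩
  have hndvd : ∀ v : ℤ, y - v ≠ 0 → |y - v| ≤ 3 → ¬ ((n : ℤ) - 1 ∣ 2 * q - c - v) := by
    intro v hv hv3 hdvd
    have h1 : (n : ℤ) - 1 ∣ y - v := by
      have := dvd_sub hdvd (Dvd.intro _ hM)
      rwa [show 2 * q - c - v - M = y - v by linarith] at this
    exact hv (Int.eq_zero_of_abs_lt_dvd h1 (by omega))
  obtain ⟨j, hj, t, ht⟩ := h.exists_head_dvd q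
    (hndvd E (by omega) (abs_le.2 (by omega))) (hndvd (E + 1) (by omega) (abs_le.2 (by omega)))
  have hJj := hconst j hj
  have hval : J (s j).head = J (s 0).head + 1 + 2 * t := by
    have : 2 * (s j).head - c + (n / 2 : ℕ) =
        (y + (n / 2 : ℕ)) + ((n : ℤ) - 1) * (J (s 0).head + 1 + 2 * t) := by
      linear_combination 2 * ht + hq - hM
    rw [hJ]
    change (2 * (s j).head - c + (n / 2 : ℕ)) / ((n : ℤ) - 1) = _
    rw [this, Int.add_mul_ediv_left _ _ hpos.ne', Int.ediv_eq_zero_of_lt (by omega) (by omega)]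
    ring
  omega

/-- The two places at a crossing, from the lower to the upper one. -/
lemma exists_crossing' (h : ReflectingPath hn L s c E z δ) (h5 : 5 ≤ n) :
    ∃ j < L, ∃ j' ≤ L, ∃ x, (s (j + 1)).head ≠ (s j).head ∧ (s j').head = x ∧
      (s j).head + (s (j + 1)).head = 2 * x - 1 ∧
      ∃ K, 2 * x - c + (n / 2 : ℕ) = ((n : ℤ) - 1) * K ∨
        2 * x - c + (n / 2 : ℕ) = ((n : ℤ) - 1) * K + 1 := by
  obtain ⟨j, hj, hJ⟩ := h.exists_crossing h5
  have hpos : (0 : ℤ) < (n : ℤ) - 1 := by omega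
  have key : ∀ x : ℤ, (2 * x - c + (n / 2 : ℕ)) / ((n : ℤ) - 1) ≠
      (2 * (x - 1) - c + (n / 2 : ℕ)) / ((n : ℤ) - 1) →
      ∃ K, 2 * x - c + (n / 2 : ℕ) = ((n : ℤ) - 1) * K ∨
        2 * x - c + (n / 2 : ℕ) = ((n : ℤ) - 1) * K + 1 := by
    intro x hx
    refine ⟨(2 * x - c + (n / 2 : ℕ)) / ((n : ℤ) - 1), ?_⟩
    have h1 := Int.mul_ediv_add_emod (2 * x - c + (n / 2 : ℕ)) ((n : ℤ) - 1)
    have h2 := Int.emod_nonneg (2 * x - c + (n / 2 : ℕ)) hpos.ne'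
    have h3 := Int.emod_lt_of_pos (2 * x - c + (n / 2 : ℕ)) hpos
    by_contra hne
    refine hx ?_
    set K := (2 * x - c + (n / 2 : ℕ)) / ((n : ℤ) - 1)
    set R := (2 * x - c + (n / 2 : ℕ)) % ((n : ℤ) - 1)
    have h4 : 2 * (x - 1) - c + (n / 2 : ℕ) = (R - 2) + ((n : ℤ) - 1) * K := by
      linear_combination -h1
    rw [h4, Int.add_mul_ediv_left _ _ hpos.ne', Int.ediv_eq_zero_of_lt (by omega) (by omega),
      zero_add]
  have hmove : (s (j + 1)).head ≠ (s j).head := fun he => hJ (by rw [he])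
  obtain ⟨w, ε, hε, -, hhead, -, -⟩ := (h.step j hj).move hmove
  rcases hε with rfl | rfl
  · refine ⟨j, hj, j + 1, hj, _, hmove, rfl, by rw [hhead]; ring, key _ ?_⟩
    rwa [hhead, add_sub_cancel_right, ← hhead]
  · refine ⟨j, hj, j, hj.le, _, hmove, rfl, by rw [hhead]; ring, key _ ?_⟩
    rw [← sub_eq_add_neg] at hhead
    rw [← hhead]
    exact hJ.symm

lemma exists_site_of_even (h : ReflectingPath hn L s c E z δ) {a : ℕ} (ha : 2 ≤ a)
    (hna : n = 2 * a) : ∃ j ≤ L, distMul (n - 1 : ℕ) (2 * (s j).head - c) = a - 1 := by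
  have hN : ((n - 1 : ℕ) : ℤ) = (n : ℤ) - 1 := by omega
  by_cases h5 : 5 ≤ n
  · obtain ⟨-, -, j, hj, x, -, rfl, -, K, hK⟩ := h.exists_crossing' h5
    refine ⟨j, hj, ?_⟩
    have hdvd : ∀ v : ℤ, 2 * (s j).head - c - v = ((n : ℤ) - 1) * (K - 1) →
        ((n - 1 : ℕ) : ℤ) ∣ 2 * (s j).head - c - v := fun v hv => by
      rw [hN]; exact Dvd.intro _ hv.symm
    rw [show n / 2 = a by omega] at hK
    have hna' : (n : ℤ) = 2 * a := by exact_mod_cast hna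
    rcases hK with hK | hK
    · rw [distMul_of_dvd (hdvd (a - 1) (by rw [mul_sub]; linarith)) (by omega) (by omega)]
      omega
    · rw [distMul_of_dvd (hdvd a (by rw [mul_sub]; linarith)) (by omega) (by omega)]
      omega
  · obtain ⟨rfl, rfl⟩ : n = 4 ∧ a = 2 := by omega
    have hE := h.side
    -- For n = 4 the modulus is 3, where 2 is its own inverse: this q makes 2q - c the one residue
    -- other than E and E+1.
    obtain ⟨j, hj, hdvd⟩ := h.exists_head_dvd (2 * (c - 1 - 2 * E)) (by omega) (by omega)
    refine ⟨j, hj, ?_⟩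
    simp only [distMul]
    omega

lemma length_lower_of_even (h : ReflectingPath hn L s c E z δ) {a : ℕ} (ha : 2 ≤ a)
    (hna : n = 2 * a) :
    a * (a - 1) + a * (a - 1) + a ≤ L + (Finset.univ.filter fun u => δ u ≠ 0).card := by
  obtain ⟨j, hj, hd⟩ := h.exists_site_of_even ha hna
  have h1 := sum_distMul_site_le hn (s j) c z
  have h2 := h.sum_site_le hj
  have h3 := h.sq_add_sq_le
  have h4 := card_parity_add z
  have h5 := swapCount_add_moveCount (s := s) L
  obtain ⟨b, rfl⟩ : ∃ b, a = b + 1 := ⟨a - 1, by omega⟩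
  have h6 := sum_distMul_odd b c
  rw [hd, show n - 1 = 2 * b + 1 by omega, h6] at h1
  set T := ∑ u, |2 * (s j).token u - c - ((n : ℤ) - 1) * z u| with hT
  set loss := (Finset.univ.filter fun u => δ u ≠ 0).card
  set b₀ := (Finset.univ.filter fun u => z u % 2 = 0).card
  set b₁ := (Finset.univ.filter fun u => z u % 2 = 1).card with hb₁
  -- The distance bound alone is one short. With balanced classes `T` has the wrong parity to attain
  -- it; with unbalanced ones an extra swap is needed.
  have hpar : T % 2 = (b₁ : ℤ) % 2 := by
    have hz : ∀ u, |2 * (s j).token u - c - ((n : ℤ) - 1) * z u| ≡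
        c + (if z u % 2 = 1 then 1 else 0) [ZMOD 2] := by
      intro u
      have e1 : |2 * (s j).token u - c - ((n : ℤ) - 1) * z u| % 2 =
          (2 * (s j).token u - c - ((n : ℤ) - 1) * z u) % 2 := by
        rcases abs_choice (2 * (s j).token u - c - ((n : ℤ) - 1) * z u) with e | e <;> rw [e]
        omega
      have e2 : ((n : ℤ) - 1) * z u = 2 * (b * z u) + z u := by
        rw [hna]; push_cast; ring
      rw [Int.ModEq, e1, e2]
      split_ifs <;> omega
    have hsum : T ≡ ∑ u : Fin n, (c + (if z u % 2 = 1 then 1 else 0)) [ZMOD 2] :=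
      Int.ModEq.sum fun u _ => hz u
    rw [Finset.sum_add_distrib, Finset.sum_const, Finset.card_univ, Fintype.card_fin,
      Finset.sum_boole, ← hb₁, nsmul_eq_mul, hna] at hsum
    rw [hsum.eq]
    push_cast
    rw [mul_assoc, Int.mul_add_emod_self_left]
  rw [Nat.add_sub_cancel]
  push_cast at h1
  have hL : swapCount s L + moveCount s 0 L = L := h5
  by_cases hb : b₁ = b + 1
  · have hb₀ : b₀ = b + 1 := by omega
    rw [hb₀, hb] at h3
    rw [hb] at hpar
    have hT' : (b : ℤ) * (b + 1) + b + 1 ≤ T := by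
      have : (b : ℤ) * (b + 1) % 2 = 0 := Int.even_iff.1 (Int.even_mul_succ_self b)
      generalize (b : ℤ) * (b + 1) = w at *
      push_cast at hpar
      omega
    have : (b + 1) ^ 2 = (b + 1) * b + (b + 1) := by ring
    have hT2 : (b + 1) * b + b + 1 ≤ moveCount s 0 L + loss := by
      zify; linarith
    omega
  · have h3' : 2 * ((b + 1) * b) + 2 ≤ 2 * swapCount s L := by
      obtain ⟨e, he⟩ : ∃ e : ℤ, (b₁ : ℤ) = b + 1 + e := ⟨b₁ - (b + 1), by ring⟩
      have he0 : (b₀ : ℤ) = b + 1 - e := by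
        have : (b₀ : ℤ) + b₁ = 2 * (b + 1) := by exact_mod_cast h4.trans hna
        linarith
      have he1 : 1 ≤ e ^ 2 := by
        have : e ≠ 0 := fun h0 => hb (by zify; rw [he, h0, add_zero])
        have := sq_pos_of_ne_zero this
        omega
      have h3z : (b₀ : ℤ) ^ 2 + (b₁ : ℤ) ^ 2 ≤ 2 * swapCount s L + 2 * (b + 1) := by
        have : ((n : ℕ) : ℤ) = 2 * (b + 1) := by exact_mod_cast hna
        rw [← this]
        exact_mod_cast h3
      rw [he, he0] at h3z
      zify
      linarith
    have hT2 : (b + 1) * b + b ≤ moveCount s 0 L + loss := by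
      zify; linarith
    omega

lemma length_lower_of_odd (h : ReflectingPath hn L s c E z δ) {a : ℕ} (ha : 2 ≤ a)
    (hna : n = 2 * a + 1) :
    2 * a ^ 2 + a ≤ L + (Finset.univ.filter fun u => δ u ≠ 0).card := by
  have hN : ((n - 1 : ℕ) : ℤ) = (n : ℤ) - 1 := by omega
  have hna' : (n : ℤ) = 2 * a + 1 := by exact_mod_cast hna
  have h3 := h.sq_add_sq_le
  have h4 := card_parity_add z
  have h5 := swapCount_add_moveCount (s := s) L
  have hS := sq_le_sum_distMul_even a c
  rw [show 2 * a = n - 1 by omega] at hS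
  set S := ∑ q ∈ Finset.range (n - 1), distMul (n - 1 : ℕ) (2 * q - c)
  set loss := (Finset.univ.filter fun u => δ u ≠ 0).card
  set b₀ := (Finset.univ.filter fun u => z u % 2 = 0).card
  set b₁ := (Finset.univ.filter fun u => z u % 2 = 1).card
  have hk : (a : ℤ) ^ 2 ≤ swapCount s L := by
    obtain ⟨e, he⟩ : ∃ e : ℤ, (b₁ : ℤ) = a + e := ⟨b₁ - a, by ring⟩
    have he0 : (b₀ : ℤ) = a + 1 - e := by
      have : (b₀ : ℤ) + b₁ = 2 * a + 1 := by exact_mod_cast h4.trans hna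
      linarith
    have he1 : 0 ≤ e * (e - 1) := by
      rcases le_or_gt e 0 with h0 | h0
      · exact mul_nonneg_of_nonpos_of_nonpos h0 (by omega)
      · exact mul_nonneg h0.le (by omega)
    have h3z : (b₀ : ℤ) ^ 2 + (b₁ : ℤ) ^ 2 ≤ 2 * swapCount s L + (2 * a + 1) := by
      rw [← hna']
      exact_mod_cast h3
    rw [he, he0] at h3z
    linarith
  have hm : (a : ℤ) ^ 2 + a ≤ moveCount s 0 L + loss := by
    obtain ⟨j, hj, j', hj', x, hmove, rfl, hmid, K, hK⟩ := h.exists_crossing' (by omega)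
    rw [show n / 2 = a by omega] at hK
    have hhalf : ∀ y : ℤ, y + a = ((n : ℤ) - 1) * K → distMul (n - 1 : ℕ) y = a := by
      intro y hy
      rw [distMul_of_dvd (v := a) _ (by omega) (by omega)]
      · omega
      · rw [hN]
        exact Dvd.intro (K - 1) (by rw [mul_sub]; linarith)
    have hpar : ((n : ℤ) - 1) * K = 2 * (a * K) := by rw [hna']; ring
    -- Either the head's place is exactly halfway, and then c and a have equal parity and `hS` loses
    -- nothing; or the middle of the edge is halfway, and the `+ 1` of the moving token repays the
    -- possible loss in `hS`.
    rcases hK with hK | hK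
    · have h1 := sum_distMul_site_le hn (s j') c z
      rw [hhalf _ hK] at h1
      have h2 := h.sum_site_le hj'
      rw [if_pos (by omega)] at hS
      linarith
    · have h1 := h.sum_distMul_edge_le hj hmove
      rw [hmid, hhalf _ (by linarith)] at h1
      have : (a : ℤ) ^ 2 - 1 ≤ S := by
        refine le_trans ?_ hS
        split_ifs <;> omega
      linarith
  zify
  have : (L : ℤ) = swapCount s L + moveCount s 0 L := by exact_mod_cast h5.symm
  linarith

/-- The common lower bound, short of one unit for every defective label. -/
lemma length_lower (h : ReflectingPath hn L s c E z δ) (h4 : 4 ≤ n) :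
    (n - n / 2) * (n - n / 2 - 1) + n / 2 * (n / 2 - 1) + n / 2 ≤
      L + (Finset.univ.filter fun u => δ u ≠ 0).card := by
  obtain ⟨a, ha⟩ := Nat.even_or_odd' n
  rcases ha with ha | ha
  · rw [show n / 2 = a by omega, show n - a = a by omega]
    exact h.length_lower_of_even (by omega) ha
  · have h1 := h.length_lower_of_odd (by omega) ha
    rw [show n / 2 = a by omega, show n - a = a + 1 by omega, Nat.add_sub_cancel]
    obtain ⟨b, rfl⟩ : ∃ b, a = b + 1 := ⟨a - 1, by omega⟩
    rw [Nat.add_sub_cancel]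
    have : (b + 1 + 1) * (b + 1) + (b + 1) * b = 2 * (b + 1) ^ 2 := by ring
    omega

end ReflectingPath

/-- The labels between which the head starts or stops shift the reflection of the tokens. -/
def labelDefect (i u : ℕ) : ℤ := (if u = 0 then 1 else 0) + if i ≤ u + 1 then 1 else 0

/-! ### Reversals as reflecting paths, and their defective labels -/

section
variable {n : ℕ} {hn : 2 ≤ n} {L i : ℕ} {s : ℕ → Conf n}

lemma Conf.pos_of_perm_eq {s : Conf n}
    (hs : s.perm = fullReversal n * leftShift n ^ ((n : ℤ) - i)) (hin : i ≤ n) (u : Fin n) :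
    s.pos u = i - 1 - u + if i ≤ (u : ℕ) then (n : ℤ) else 0 := by
  have hu := u.2
  obtain ⟨x, hx⟩ : ∃ x : Fin n,
      ((x : ℕ) : ℤ) = i - 1 - u + if i ≤ (u : ℕ) then (n : ℤ) else 0 := by
    split_ifs with h
    · exact ⟨⟨i + n - 1 - u, by omega⟩, by change ((i + n - 1 - u : ℕ) : ℤ) = _; omega⟩
    · exact ⟨⟨i - 1 - u, by omega⟩, by change ((i - 1 - u : ℕ) : ℤ) = _; omega⟩
  have : s.perm x = u := by
    refine Fin.eq_of_val_modEq ?_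
    rw [hs]
    refine (fullReversal_mul_leftShift_zpow_modEq _ x).trans ?_
    rw [hx]
    refine (Int.modEq_iff_dvd).2 ?_
    split_ifs
    · exact ⟨2, by ring⟩
    · exact ⟨1, by ring⟩
  rw [← hx, Conf.pos, ← this, ← Perm.mul_apply, inv_mul_cancel, Perm.one_apply]

/-- A word for a reversal-type permutation reflects the tokens. The parameter `e` selects which
labels count as defective. -/
lemma ReflectingPath.of_reversal (h0 : s 0 = Conf.start n)
    (hs : ∀ j < L, Step hn (s j) (s (j + 1)))
    (hL : (s L).perm = fullReversal n * leftShift n ^ ((n : ℤ) - i)) (hi : 1 ≤ i) (hin : i ≤ n)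
    {e E : ℤ} (hE : E = -1 ∨ E = 0)
    (he : ∀ u : Fin n, labelDefect i u - e = E ∨ labelDefect i u - e = E + 1) :
    ReflectingPath hn L s ((s L).head + i - 3 + e) E
      (fun u => (s L).wind u + if i ≤ (u : ℕ) then 1 else 0) (fun u => labelDefect i u - e) := by
  refine ⟨h0, hs, fun u => ?_, he, hE, fun a b hab hz => ?_⟩
  · have hu := u.2
    have hpos := Conf.pos_of_perm_eq hL hin u
    have hp0 : (s 0).token u = max (((u : ℕ) : ℤ) - 1) 0 := by
      rw [h0]; simp [Conf.token, Conf.pos, Conf.start]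
    rw [hp0, Conf.token, hpos, labelDefect, mul_add]
    generalize ((n : ℤ) - 1) * (s L).wind u = w
    split_ifs <;> simp only [mul_one, mul_zero] <;> omega
  -- The final order comes out as z b - z a - [a < b], the initial one is -[b < a]. For a ≠ b they
  -- agree only if z b - z a = ±1, which equal parity excludes.
  · have ha := a.2
    have hb := b.2
    have hne : (a : ℕ) ≠ b := fun h => hab (Fin.ext h)
    have ho : (s 0).order a b = - if (b : ℕ) < a then 1 else 0 := by
      rw [h0]; simp [Conf.order, Conf.pos, Conf.start]
    rw [ho, Conf.order, Conf.pos_of_perm_eq hL hin, Conf.pos_of_perm_eq hL hin]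
    split_ifs at hz ⊢ <;> omega

lemma HasWord.reversal_lower {k : ℕ} (h4 : 4 ≤ n)
    (h : HasWord n hn k (fullReversal n * _root_.leftShift n ^ ((n : ℤ) - i))) (hi : 1 ≤ i) (hin : i ≤ n)
    {e E : ℤ} (hE : E = -1 ∨ E = 0)
    (he : ∀ u : Fin n, labelDefect i u - e = E ∨ labelDefect i u - e = E + 1) :
    (n - n / 2) * (n - n / 2 - 1) + n / 2 * (n / 2 - 1) + n / 2 ≤
      k + (Finset.univ.filter fun u : Fin n => labelDefect i u - e ≠ 0).card := by
  obtain ⟨s, h0, hL, hs⟩ := exists_path_of_hasWord h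
  exact (ReflectingPath.of_reversal h0 hs hL hi hin hE he).length_lower h4

lemma HasWord.reversal_lower_one {k : ℕ} (h4 : 4 ≤ n)
    (h : HasWord n hn k (fullReversal n * _root_.leftShift n ^ ((n : ℤ) - 1))) :
    (n - n / 2) * (n - n / 2 - 1) + n / 2 * (n / 2 - 1) + n / 2 ≤ k + 1 := by
  have := HasWord.reversal_lower (i := 1) (e := 1) (E := 0) h4 (by simpa using h) le_rfl (by omega)
    (Or.inr rfl) (fun u => by simp only [labelDefect]; split_ifs <;> omega)
  refine this.trans (Nat.add_le_add_left (Finset.card_le_one.2 ?_) _)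
  intro u hu v hv
  replace hu := (Finset.mem_filter.1 hu).2
  replace hv := (Finset.mem_filter.1 hv).2
  simp only [labelDefect] at hu hv
  apply Fin.ext
  split_ifs at hu hv <;> omega

/-- With `e = 1` the defective labels are 1, …, i-2; this is the sharp choice for i ≤ ⌊n/2⌋ + 2. -/
lemma HasWord.reversal_lower_left {k : ℕ} (h4 : 4 ≤ n) (hi : 2 ≤ i) (hin : i ≤ n)
    (h : HasWord n hn k (fullReversal n * _root_.leftShift n ^ ((n : ℤ) - i))) :
    (n - n / 2) * (n - n / 2 - 1) + n / 2 * (n / 2 - 1) + n / 2 ≤ k + (i - 2) := by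
  have := HasWord.reversal_lower (e := 1) (E := -1) h4 h (by omega) hin
    (Or.inl rfl) (fun u => by simp only [labelDefect]; split_ifs <;> omega)
  refine this.trans (Nat.add_le_add_left ?_ _)
  refine (Finset.card_le_card_of_injOn (t := Finset.Ico 1 (i - 1)) (fun u : Fin n => (u : ℕ)) ?_
    (fun u _ v _ huv => Fin.ext huv)).trans ?_
  · intro u hu
    replace hu := (Finset.mem_filter.1 (Finset.mem_coe.1 hu)).2
    simp only [labelDefect] at hu
    simp only [Finset.coe_Ico, Set.mem_Ico]
    split_ifs at hu <;> omega
  · simp; omega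

/-- With `e = 0` the defective labels are 0 and i-1, …, n-1; this is the sharp choice for i ≥ ⌈n/2⌉
+ 2. -/
lemma HasWord.reversal_lower_right {k : ℕ} (h4 : 4 ≤ n) (hi : 2 ≤ i) (hin : i ≤ n)
    (h : HasWord n hn k (fullReversal n * _root_.leftShift n ^ ((n : ℤ) - i))) :
    (n - n / 2) * (n - n / 2 - 1) + n / 2 * (n / 2 - 1) + n / 2 ≤ k + (n - i + 2) := by
  have := HasWord.reversal_lower (e := 0) (E := 0) h4 h (by omega) hin
    (Or.inr rfl) (fun u => by simp only [labelDefect]; split_ifs <;> omega)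
  refine this.trans (Nat.add_le_add_left ?_ _)
  refine (Finset.card_le_card_of_injOn (t := insert 0 (Finset.Ico (i - 1) n))
    (fun u : Fin n => (u : ℕ)) ?_ (fun u _ v _ huv => Fin.ext huv)).trans ?_
  · intro u hu
    have := u.2
    replace hu := (Finset.mem_filter.1 (Finset.mem_coe.1 hu)).2
    simp only [labelDefect] at hu
    simp only [Finset.coe_insert, Finset.coe_Ico, Set.mem_insert_iff, Set.mem_Ico]
    split_ifs at hu <;> omega
  · refine (Finset.card_insert_le _ _).trans ?_
    simp; omega

end

/-! ### Exact distances -/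

lemma dist_reversal_of_le {n : ℕ} (hn : 2 ≤ n) (h4 : 4 ≤ n) {i : ℕ} (hi : 2 ≤ i) (hin : i ≤ n)
    (h : i ≤ n / 2 + 2) :
    (shiftSwapGraph n hn).dist (fullReversal n * leftShift n ^ ((n : ℤ) - i)) 1 =
      (n - n / 2) * (n - n / 2 - 1) + n / 2 * (n / 2 - 1) + (n / 2 + 2 - i) := by
  have hw := HasWord.reversal_of_le (hn := hn) h4 i h
  have h1 := hw.dist_le
  have h2 := hw.hasWord_dist.reversal_lower_left h4 hi hin
  omega

lemma dist_reversal_of_ge {n : ℕ} (hn : 2 ≤ n) (h4 : 4 ≤ n) {i : ℕ} (hin : i ≤ n)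
    (h : n - n / 2 + 2 ≤ i) :
    (shiftSwapGraph n hn).dist (fullReversal n * leftShift n ^ ((n : ℤ) - i)) 1 =
      (n - n / 2) * (n - n / 2 - 1) + n / 2 * (n / 2 - 1) + (i - (n - n / 2 + 2)) := by
  have hw := HasWord.reversal_of_ge (hn := hn) h4 i h
  have h1 := hw.dist_le
  have h2 := hw.hasWord_dist.reversal_lower_right h4 (by omega) hin
  omega

lemma dist_reversal_one {n : ℕ} (hn : 2 ≤ n) (h4 : 4 ≤ n) :
    (shiftSwapGraph n hn).dist (fullReversal n * leftShift n ^ ((n : ℤ) - 1)) 1 =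
      (n - n / 2) * (n - n / 2 - 1) + n / 2 * (n / 2 - 1) + (n / 2 - 1) := by
  -- The exponent matters only modulo n, so i = 1 is reached as i = n+1, from the upper of the two
  -- nearest reversals.
  have hw := (HasWord.reversal_of_ge (hn := hn) h4 (n + 1) (by omega)).fullReversal_mul_congr
    (k' := (n : ℤ) - 1) (by simp [Int.modEq_iff_dvd])
  have h1 := hw.dist_le
  have h2 := hw.hasWord_dist.reversal_lower_one h4
  omega

theorem theorem1 (n : ℕ) (hn : 4 ≤ n) (i : ℕ) (hi1 : 1 ≤ i) (hin : i ≤ n) :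
    (i = 1 →
      ((shiftSwapGraph n (by omega)).dist (fullReversal n * leftShift n ^ (n - i)) 1 : ℤ) =
        ⌈(n : ℚ) / 2⌉ * (⌈(n : ℚ) / 2⌉ - 1) - 1 + ⌊(n : ℚ) / 2⌋ * (⌊(n : ℚ) / 2⌋ - 1) - 1
          + (⌊(n : ℚ) / 2⌋ + 1)) ∧
    (2 ≤ i ∧ (i : ℤ) ≤ ⌊(n : ℚ) / 2⌋ + 2 →
      ((shiftSwapGraph n (by omega)).dist (fullReversal n * leftShift n ^ (n - i)) 1 : ℤ) =
        ⌈(n : ℚ) / 2⌉ * (⌈(n : ℚ) / 2⌉ - 1) - 1 + ⌊(n : ℚ) / 2⌋ * (⌊(n : ℚ) / 2⌋ - 1) - 1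
          + (⌊(n : ℚ) / 2⌋ - i + 4)) ∧
    (⌈(n : ℚ) / 2⌉ + 2 ≤ (i : ℤ) ∧ i ≤ n →
      ((shiftSwapGraph n (by omega)).dist (fullReversal n * leftShift n ^ (n - i)) 1 : ℤ) =
        ⌈(n : ℚ) / 2⌉ * (⌈(n : ℚ) / 2⌉ - 1) - 1 + ⌊(n : ℚ) / 2⌋ * (⌊(n : ℚ) / 2⌋ - 1) - 1
          + (i - ⌈(n : ℚ) / 2⌉)) := by
  have hfloor : ⌊(n : ℚ) / 2⌋ = ((n / 2 : ℕ) : ℤ) := by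
    obtain ⟨a, ha⟩ : ∃ a, n / 2 = a := ⟨_, rfl⟩
    have h1 : ((2 * a : ℕ) : ℚ) ≤ n := by exact_mod_cast (by omega)
    have h2 : (n : ℚ) < ((2 * a + 2 : ℕ) : ℚ) := by exact_mod_cast (by omega)
    rw [ha, Int.floor_eq_iff]
    push_cast at h1 h2 ⊢
    constructor <;> linarith
  have hceil : ⌈(n : ℚ) / 2⌉ = ((n - n / 2 : ℕ) : ℤ) := by
    obtain ⟨a, ha⟩ : ∃ a, n - n / 2 = a := ⟨_, rfl⟩
    have h1 : (n : ℚ) ≤ ((2 * a : ℕ) : ℚ) := by exact_mod_cast (by omega)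
    have h2 : ((2 * a : ℕ) : ℚ) < ((n + 2 : ℕ) : ℚ) := by exact_mod_cast (by omega)
    rw [ha, Int.ceil_eq_iff]
    push_cast at h1 h2 ⊢
    constructor <;> linarith
  have hpow : leftShift n ^ (n - i) = leftShift n ^ ((n : ℤ) - i) := by
    rw [← zpow_natCast, Nat.cast_sub hin]
  rw [hfloor, hceil, hpow]
  refine ⟨?_, fun h => ?_, fun h => ?_⟩
  · rintro rfl
    rw [Nat.cast_one, dist_reversal_one _ hn]
    push_cast [show 1 ≤ n - n / 2 by omega, show 1 ≤ n / 2 by omega]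
    ring
  · rw [dist_reversal_of_le _ hn h.1 hin (by omega)]
    push_cast [show 1 ≤ n - n / 2 by omega, show 1 ≤ n / 2 by omega,
      show i ≤ n / 2 + 2 by omega]
    ring
  · rw [dist_reversal_of_ge _ hn hin (by omega)]
    push_cast [show 1 ≤ n - n / 2 by omega, show 1 ≤ n / 2 by omega,
      show n - n / 2 + 2 ≤ i by omega]
    ring
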